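/- Setting. Consider a two-dimensional conformal field theory on $\mathbb{CP}^1$ with $\mathbb{Z}$-graded space of fields $V$ (the parity of the degree is the statistics), identity field $\mathbb{1}$, stress-energy tensor $T,\overline{T}$ and Virasoro operators $L_k,\overline{L}_k$ on $V$. Its correlators $\langle\Phi_1(z_1)\cdots\Phi_n(z_n)\rangle$ are multilinear in the fields, graded-symmetric, smooth on the configuration space $C_n(\mathbb{CP}^1)$ of $n$-tuples of distinct points, and Möbius invariant. A field at a point is taken with respect to a Möbius coordinate centred there; $L_{-1},\overline{L}_{-1}$ are the derivatives $\partial,\bar\partial$ in its position, $L_0,\overline L_0$ and $L_1,\overline L_1$ generate the dilations and special conformal changes of the coordinate, and $L_k,\overline L_k$ are given by contour integrals of $T,\overline T$. The theory is a topological CFT (TCFT): $V$ is a cochain complex with differential $Q$ of degree $+1$, $Q^2=0$, and (a) $T=Q(G)$, $\overline{T}=Q(\overline{G})$, where $G$ is a holomorphic $(2,0)$-primary field and $\overline{G}$ an antiholomorphic $(0,2)$-primary field, both of degree $-1$, and the operator products $GG$, $G\overline{G}$, $\overline{G}\,\overline{G}$ are regular; (b) there are fields $J,\bar J$ of degree $+1$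 and conformal weights $(1,0)$, $(0,1)$ such that $\mathbb{J}=dz\,J+d\bar z\,\bar J$ is a 1-form-valued field on $\mathbb{CP}^1$ (i.e. independent of the Möbius coordinate: $L_1,\overline{L}_1$ annihilate $J,\bar J$), it is closed, $\bar\partial J-\partial\bar J=0$, one has $$Q\Phi(z)=\frac{1}{2\pi i}\oint_{\gamma_z}\mathbb{J}(w)\,\Phi(z)$$ under correlators, for $\gamma_z$ a small contour around $z$, and $\oint_{\gamma_z}\mathbb{J}(w)\,\mathbb{J}(z)=0$; (c) $\mathbb{1}$ is not $Q$-exact. Lemma. In a TCFT, let $\Phi_1,\ldots,\Phi_n\in V$ be $Q$-closed, i.e. $Q\Phi_i=0$. Then: (i) The correlator $\langle\Phi_1(z_1)\cdots\Phi_n(z_n)\rangle$ on $\mathbb{CP}^1$ is a constant function on $C_n(\mathbb{CP}^1)$; the constant does not depend on the Möbius coordinates centred at the points either. (ii) For any $\Psi\in V$ and any distinct points $z_0,\ldots,z_n\in\mathbb{CP}^1$, $$\langle Q\Psi(z_0)\,\Phi_1(z_1)\cdots\Phi_n(z_n)\rangle=0 .$$ -/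

import Mathlib

namespace TopCFT

open Matrix Filter Topology Asymptotics ComplexConjugate
open scoped ContDiff MatrixGroups

/-- A Möbius coordinate on the Riemann sphere, given by `g ∈ SL(2, ℂ)`: the local coordinate `ζ`
is centred at the point `g • 0`, and `ζ` is the coordinate of the point `g • ζ`. -/
abbrev Frame : Type := SL(2, ℂ)

/-- The centre `g • 0` of a Möbius coordinate, a point of the Riemann sphere `ℂ ∪ {∞}`. -/
noncomputable def Frame.center (g : Frame) : OnePoint ℂ :=
  (g : GL (Fin 2) ℂ) • ((0 : ℂ) : OnePoint ℂ)

/-- The translation `ζ ↦ ζ + x`. -/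
def shift (x : ℂ) : Frame := ⟨!![1, x; 0, 1], by simp⟩

/-- The dilation `ζ ↦ exp(s) ζ`. -/
noncomputable def dil (s : ℂ) : Frame :=
  ⟨!![Complex.exp (s / 2), 0; 0, Complex.exp (-(s / 2))], by simp [← Complex.exp_add]⟩

/-- The special conformal transformation `ζ ↦ ζ / (x ζ + 1)`. -/
def special (x : ℂ) : Frame := ⟨!![1, 0; x, 1], by simp⟩

/-- The centres of the given Möbius coordinates are a point of the configuration space of the
Riemann sphere, i.e. they are pairwise distinct. -/
def Separated {n : ℕ} (g : Fin n → Frame) : Prop :=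
  Function.Injective fun i => (g i).center

/-- `(2πi)⁻¹ ∮ (f dw + h dw̄)` over the counterclockwise circle `|w| = r`. -/
noncomputable def oint (f h : ℂ → ℂ) (r : ℝ) : ℂ :=
  (2 * (Real.pi : ℂ) * Complex.I)⁻¹ *
    ((∮ w in C(0, r), f w) + conj (∮ w in C(0, r), conj (h w)))

/-- A two-dimensional conformal field theory on the Riemann sphere, in terms of the correlators of
its space of fields `V`. The fields are `ℤ`-graded, the parity of the degree being the statistics
of a field. A field is inserted at a point with respect to a local coordinate centred there;
`corr n g Φ` is the correlator `⟨Φ 0 ⋯ Φ (n-1)⟩` with `Φ i` inserted at the centre of the Möbius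
coordinate `g i`, and with respect to that coordinate. It is meaningful when these centres are
distinct. In particular `g i = shift z` is the insertion at `z ∈ ℂ` in the standard coordinate. -/
structure SphereCFT (V : Type*) [AddCommGroup V] [Module ℂ V] where
  /-- the degree -/
  gr : ℤ → Submodule ℂ V
  gr_internal : DirectSum.IsInternal gr
  /-- the correlators -/
  corr : (n : ℕ) → (Fin n → Frame) → MultilinearMap ℂ (fun _ : Fin n => V) ℂ
  /-- the identity field -/
  one : V
  /-- the stress-energy tensor -/
  T : V
  Tbar : V
  /-- the Virasoro operators -/
  L : ℤ → Module.End ℂ V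
  Lbar : ℤ → Module.End ℂ V
  /-- the central charges -/
  c : ℂ
  cbar : ℂ
  one_mem : one ∈ gr 0
  T_mem : T ∈ gr 0
  Tbar_mem : Tbar ∈ gr 0
  L_mem : ∀ n k, ∀ Φ ∈ gr k, L n Φ ∈ gr k
  Lbar_mem : ∀ n k, ∀ Φ ∈ gr k, Lbar n Φ ∈ gr k
  /-- graded symmetry -/
  corr_swap : ∀ (n : ℕ) (i : Fin n) (g : Fin (n + 1) → Frame) (Φ : Fin (n + 1) → V) (a b : ℤ),
    Separated g → Φ i.castSucc ∈ gr a → Φ i.succ ∈ gr b →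
    corr (n + 1) (g ∘ Equiv.swap i.castSucc i.succ) (Φ ∘ Equiv.swap i.castSucc i.succ) =
      (-1 : ℂ) ^ (a * b) * corr (n + 1) g Φ
  corr_one : ∀ (n : ℕ) (g₀ : Frame) (g : Fin n → Frame) (Φ : Fin n → V),
    Separated (vecCons g₀ g) →
    corr (n + 1) (vecCons g₀ g) (vecCons one Φ) = corr n g Φ
  /-- correlators are smooth functions of the positions of the fields -/
  corr_smooth : ∀ (n : ℕ) (g : Fin n → Frame) (Φ : Fin n → V), Separated g →
    ContDiffAt ℝ ∞ (fun x : Fin n → ℂ => corr n (fun i => g i * shift (x i)) Φ) 0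
  /-- invariance under the conformal automorphisms of the sphere -/
  corr_mobius : ∀ (n : ℕ) (h : Frame) (g : Fin n → Frame) (Φ : Fin n → V), Separated g →
    corr n (fun i => h * g i) Φ = corr n g Φ
  /-- `L₋₁` and `L̄₋₁` are the derivatives in the position of a field -/
  corr_trans : ∀ (n : ℕ) (g : Fin n → Frame) (Φ : Fin n → V) (i : Fin n) (x : ℂ), Separated g →
    HasDerivAt (fun t : ℝ => corr n (Function.update g i (g i * shift (t * x))) Φ)
      (x * corr n g (Function.update Φ i (L (-1) (Φ i))) +
        conj x * corr n g (Function.update Φ i (Lbar (-1) (Φ i)))) 0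
  /-- `L₀` and `L̄₀` generate the dilations of the local coordinate -/
  corr_dil : ∀ (n : ℕ) (g : Fin n → Frame) (Φ : Fin n → V) (i : Fin n) (x : ℂ), Separated g →
    HasDerivAt (fun t : ℝ => corr n (Function.update g i (g i * dil (t * x))) Φ)
      (x * corr n g (Function.update Φ i (L 0 (Φ i))) +
        conj x * corr n g (Function.update Φ i (Lbar 0 (Φ i)))) 0
  /-- `L₁` and `L̄₁` generate the special conformal changes `ζ ↦ ζ - x ζ² + ⋯` of the local
  coordinate -/
  corr_special : ∀ (n : ℕ) (g : Fin n → Frame) (Φ : Fin n → V) (i : Fin n) (x : ℂ), Separated g →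
    HasDerivAt (fun t : ℝ => corr n (Function.update g i (g i * special (t * x))) Φ)
      (-(x * corr n g (Function.update Φ i (L 1 (Φ i))) +
        conj x * corr n g (Function.update Φ i (Lbar 1 (Φ i))))) 0
  /-- `Lₖ Φ(0) = (2πi)⁻¹ ∮ dw w ^ (k + 1) T(w) Φ(0)` in any Möbius coordinate -/
  corr_L : ∀ (n : ℕ) (g₀ : Frame) (g : Fin n → Frame) (Φ₀ : V) (Φ : Fin n → V) (k : ℤ),
    Separated (vecCons g₀ g) → ∀ᶠ r : ℝ in 𝓝[>] 0,
    corr (n + 1) (vecCons g₀ g) (vecCons (L k Φ₀) Φ) =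
      oint (fun w => w ^ (k + 1) * corr (n + 2) (vecCons (g₀ * shift w) (vecCons g₀ g))
        (vecCons T (vecCons Φ₀ Φ))) 0 r
  /-- the complex conjugate formula for `L̄ₖ`; the sign is there because `∮ dw̄ / w̄ = -2πi` over a
  counterclockwise circle -/
  corr_Lbar : ∀ (n : ℕ) (g₀ : Frame) (g : Fin n → Frame) (Φ₀ : V) (Φ : Fin n → V) (k : ℤ),
    Separated (vecCons g₀ g) → ∀ᶠ r : ℝ in 𝓝[>] 0,
    corr (n + 1) (vecCons g₀ g) (vecCons (Lbar k Φ₀) Φ) =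
      -oint 0 (fun w => conj w ^ (k + 1) * corr (n + 2) (vecCons (g₀ * shift w) (vecCons g₀ g))
        (vecCons Tbar (vecCons Φ₀ Φ))) r
  /-- the Virasoro relations -/
  virasoro : ∀ m n : ℤ, L m * L n - L n * L m =
    ((m : ℂ) - n) • L (m + n) +
      (if m + n = 0 then c / 12 * ((m : ℂ) ^ 3 - m) else 0) • (1 : Module.End ℂ V)
  virasoro_bar : ∀ m n : ℤ, Lbar m * Lbar n - Lbar n * Lbar m =
    ((m : ℂ) - n) • Lbar (m + n) +
      (if m + n = 0 then cbar / 12 * ((m : ℂ) ^ 3 - m) else 0) • (1 : Module.End ℂ V)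
  L_Lbar : ∀ m n : ℤ, Commute (L m) (Lbar n)
  L_one : ∀ n : ℤ, -1 ≤ n → L n one = 0
  Lbar_one : ∀ n : ℤ, -1 ≤ n → Lbar n one = 0
  T_eq : T = L (-2) one
  Tbar_eq : Tbar = Lbar (-2) one
  /-- operator product expansions: near the centre of `g₀`, the product of `Φ` and `Ψ` is, to any
  order, a finite sum of fields with coefficient functions; they depend on `Φ` and `Ψ` only -/
  ope : ∀ (Φ Ψ : V) (N : ℕ), ∃ (m : ℕ) (f : Fin m → ℂ → ℂ) (X : Fin m → V),
    ∀ (n : ℕ) (g₀ : Frame) (g : Fin n → Frame) (Y : Fin n → V), Separated (vecCons g₀ g) →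
    (fun w : ℂ => corr (n + 2) (vecCons (g₀ * shift w) (vecCons g₀ g)) (vecCons Φ (vecCons Ψ Y)) -
      ∑ k, f k w * corr (n + 1) (vecCons g₀ g) (vecCons (X k) Y))
      =O[𝓝[≠] 0] fun w => ‖w‖ ^ N

namespace SphereCFT

variable {V : Type*} [AddCommGroup V] [Module ℂ V]

/-- `Φ` has conformal weight `(h, hb)`. -/
def HasWeight (C : SphereCFT V) (Φ : V) (h hb : ℂ) : Prop :=
  C.L 0 Φ = h • Φ ∧ C.Lbar 0 Φ = hb • Φ

/-- `Φ` is an `(h, hb)`-primary field. -/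
def IsPrimary (C : SphereCFT V) (Φ : V) (h hb : ℂ) : Prop :=
  C.HasWeight Φ h hb ∧ ∀ n : ℤ, 1 ≤ n → C.L n Φ = 0 ∧ C.Lbar n Φ = 0

/-- `∂̄ Φ = 0`. -/
def IsHolomorphic (C : SphereCFT V) (Φ : V) : Prop := C.Lbar (-1) Φ = 0

/-- `∂ Φ = 0`. -/
def IsAntiholomorphic (C : SphereCFT V) (Φ : V) : Prop := C.L (-1) Φ = 0

/-- The operator product `Φ(w) Ψ(z)` of two fields, each of which is holomorphic or
antiholomorphic, is regular: under correlators it stays bounded as `w → z`. -/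
def RegularOPE (C : SphereCFT V) (Φ Ψ : V) : Prop :=
  ∀ (n : ℕ) (g₀ : Frame) (g : Fin n → Frame) (Y : Fin n → V), Separated (vecCons g₀ g) →
    (fun w : ℂ => C.corr (n + 2) (vecCons (g₀ * shift w) (vecCons g₀ g))
      (vecCons Φ (vecCons Ψ Y))) =O[𝓝[≠] 0] fun _ => (1 : ℝ)

/-- The contour integral `(2πi)⁻¹ ∮ (dw A(w) + dw̄ B(w)) Φ₀(z)` over the circle of radius `r` about
`z` in the Möbius coordinate `g₀` centred at `z`, in a correlator with further fields `Φ`. -/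
noncomputable def current (C : SphereCFT V) (A B : V) {n : ℕ} (g₀ : Frame) (g : Fin n → Frame)
    (Φ₀ : V) (Φ : Fin n → V) (r : ℝ) : ℂ :=
  oint
    (fun w => C.corr (n + 2) (vecCons (g₀ * shift w) (vecCons g₀ g)) (vecCons A (vecCons Φ₀ Φ)))
    (fun w => C.corr (n + 2) (vecCons (g₀ * shift w) (vecCons g₀ g)) (vecCons B (vecCons Φ₀ Φ))) r

end SphereCFT

/-- A topological conformal field theory on the Riemann sphere. -/
structure SphereTCFT (V : Type*) [AddCommGroup V] [Module ℂ V] extends SphereCFT V where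
  /-- the differential -/
  Q : Module.End ℂ V
  G : V
  Gbar : V
  J : V
  Jbar : V
  Q_mem : ∀ k, ∀ Φ ∈ gr k, Q Φ ∈ gr (k + 1)
  Q_Q : ∀ Φ, Q (Q Φ) = 0
  G_mem : G ∈ gr (-1)
  Gbar_mem : Gbar ∈ gr (-1)
  J_mem : J ∈ gr 1
  Jbar_mem : Jbar ∈ gr 1
  T_exact : T = Q G
  Tbar_exact : Tbar = Q Gbar
  G_G : toSphereCFT.RegularOPE G G
  G_Gbar : toSphereCFT.RegularOPE G Gbar
  Gbar_Gbar : toSphereCFT.RegularOPE Gbar Gbar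
  G_primary : toSphereCFT.IsPrimary G 2 0
  G_holomorphic : toSphereCFT.IsHolomorphic G
  Gbar_primary : toSphereCFT.IsPrimary Gbar 0 2
  Gbar_antiholomorphic : toSphereCFT.IsAntiholomorphic Gbar
  J_weight : toSphereCFT.HasWeight J 1 0
  Jbar_weight : toSphereCFT.HasWeight Jbar 0 1
  /-- `dz J + dz̄ J̄` is a 1-form-valued field on the sphere: together with the weights, this says
  that it does not depend on the choice of the Möbius coordinate -/
  oneForm : (L 1 J = 0 ∧ Lbar 1 J = 0) ∧ (L 1 Jbar = 0 ∧ Lbar 1 Jbar = 0)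
  /-- the 1-form-valued field `dz J + dz̄ J̄` is closed: `∂̄ J - ∂ J̄ = 0` -/
  closed : Lbar (-1) J - L (-1) Jbar = 0
  /-- `Q Φ(z) = (2πi)⁻¹ ∮ (dw J(w) + dw̄ J̄(w)) Φ(z)`, over small circles about `z` -/
  corr_Q : ∀ (n : ℕ) (g₀ : Frame) (g : Fin n → Frame) (Φ₀ : V) (Φ : Fin n → V),
    Separated (vecCons g₀ g) → ∀ᶠ r : ℝ in 𝓝[>] 0,
    corr (n + 1) (vecCons g₀ g) (vecCons (Q Φ₀) Φ) = toSphereCFT.current J Jbar g₀ g Φ₀ Φ r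
  /-- the contour integral of `dw J(w) + dw̄ J̄(w)` about `dz J(z) + dz̄ J̄(z)` vanishes -/
  J_J : ∀ (n : ℕ) (g₀ : Frame) (g : Fin n → Frame) (Φ : Fin n → V),
    Separated (vecCons g₀ g) → ∀ᶠ r : ℝ in 𝓝[>] 0,
    toSphereCFT.current J Jbar g₀ g J Φ r = 0 ∧ toSphereCFT.current J Jbar g₀ g Jbar Φ r = 0
  /-- the identity field is not exact -/
  one_not_exact : ∀ Φ, Q Φ ≠ one

end TopCFT

/-!
The differential acts on a field `Φ(z)` by the integral of the current `dw J(w) + dw̄ J̄(w)` over a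
small circle about `z`. The current is a closed 1-form on the sphere minus the other insertions, so
its integrals about all insertions add up to zero: this is the Ward identity of `Q`. If all fields
but `Ψ` are closed, the current has no residues except at `Ψ`, hence none there either, and
`⟨QΨ Φ 0 ⋯ Φ (n-1)⟩ = 0` (`corr_exact_at_infinity` and, for inhomogeneous fields, `corr_exact`).

Instead of Stokes' theorem on a punctured sphere the proof uses primitives. A closed 1-form on a
punctured disc is exact there iff its integrals over small circles vanish
(`exactNear_of_oint_eq_zero`, `ExactNear.oint_eq_zero`), and a closed 1-form on the plane that is
exact near each of its finitely many punctures is exact near infinity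
(`exists_primitive_near_infinity`). A Möbius transformation puts `Ψ` at infinity. Existence of a
primitive does not depend on the coordinate, since `J` and `J̄` have weights `(1, 0)` and `(0, 1)`
and do not see special conformal changes (`hasFDerivAt_comp_moebius`).

As `T` and `T̄` are exact, their correlators with closed fields vanish, and so do those of `Lₖ Φ`
and `L̄ₖ Φ` for closed `Φ`, which are contour integrals of the former (`corr_virasoro_eq_zero`).
For `k = -1, 0, 1` this says that a correlator of closed fields is stationary under translations,
dilations and special conformal changes of each Möbius coordinate. These generate `SL(2, ℂ)`, and
the plane minus finitely many points is connected, so the correlator is constant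
(`corr_move_first`, `corr_eq_of_closed`).
-/

namespace TopCFT

open Matrix Filter Topology ComplexConjugate
open scoped MatrixGroups

/-! ### Closed and exact 1-forms on the plane -/

/-- The value `a dz + b dz̄` of a 1-form at a point. -/
noncomputable def form (a b : ℂ) : ℂ →L[ℝ] ℂ :=
  a • ContinuousLinearMap.id ℝ ℂ + b • (Complex.conjCLE : ℂ →L[ℝ] ℂ)

@[simp] lemma form_apply (a b v : ℂ) : form a b v = a * v + b * conj v := by
  simp [form]

/-- The 1-form `ω` is differentiable and closed at `z`. -/
def ClosedAt (ω : ℂ → ℂ →L[ℝ] ℂ) (z : ℂ) : Prop :=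
  DifferentiableAt ℝ ω z ∧ ∀ u v, fderiv ℝ ω z u v = fderiv ℝ ω z v u

/-- The 1-form `ω` is exact on a punctured neighbourhood of `z`. -/
def ExactNear (ω : ℂ → ℂ →L[ℝ] ℂ) (z : ℂ) : Prop :=
  ∃ P : ℂ → ℂ, ∀ᶠ y in 𝓝[≠] z, HasFDerivAt P (ω y) y

lemma ClosedAt.congr {ω η : ℂ → ℂ →L[ℝ] ℂ} {z : ℂ} (h : ClosedAt ω z) (e : η =ᶠ[𝓝 z] ω) :
    ClosedAt η z :=
  ⟨h.1.congr_of_eventuallyEq e, by rw [e.fderiv_eq]; exact h.2⟩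

lemma ClosedAt.of_primitive {ω : ℂ → ℂ →L[ℝ] ℂ} {z : ℂ} {P : ℂ → ℂ}
    (hd : DifferentiableAt ℝ ω z) (hP : ∀ᶠ y in 𝓝 z, HasFDerivAt P (ω y) y) : ClosedAt ω z :=
  ⟨hd, fun u v => second_derivative_symmetric_of_eventually hP hd.hasFDerivAt u v⟩

/-- A 1-form on the plane that is closed away from finitely many punctures and exact near each of
them is exact near infinity: subtracting `d(χ F)`, with `F` a primitive near a puncture and `χ` a
bump function there, removes the puncture, and without punctures this is the Poincaré lemma. -/
theorem exists_primitive_near_infinity (S : Finset ℂ) (ω : ℂ → ℂ →L[ℝ] ℂ)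
    (hc : ∀ z ∉ S, ClosedAt ω z) (he : ∀ s ∈ S, ExactNear ω s) :
    ∃ P : ℂ → ℂ, ∀ᶠ z in Bornology.cobounded ℂ, HasFDerivAt P (ω z) z := by
  induction S using Finset.induction_on generalizing ω with
  | empty =>
    obtain ⟨P, hP⟩ := (convex_univ (𝕜 := ℝ) (E := ℂ)).exists_forall_hasFDerivAt_of_fderiv_symmetric
      isOpen_univ (fun z _ => ((hc z (by simp)).1).differentiableWithinAt)
      (fun z _ => (hc z (by simp)).2)
    exact ⟨P, Eventually.of_forall fun z => hP z trivial⟩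
  | insert s S hs ih =>
    obtain ⟨F, hF⟩ := he s (by simp)
    have hS : ∀ᶠ y in 𝓝 s, y ∉ S := S.finite_toSet.isClosed.isOpen_compl.mem_nhds hs
    obtain ⟨ε, ε0, hε⟩ := Metric.eventually_nhds_iff.1 ((eventually_nhdsWithin_iff.1 hF).and hS)
    let χ : ContDiffBump s := ⟨ε / 3, ε / 2, by positivity, by linarith⟩
    set χ' : ℂ → ℂ := fun z => (χ z : ℂ) with hχ'
    have hχd : ContDiff ℝ 2 χ' := Complex.ofRealCLM.contDiff.comp χ.contDiff
    have hχd2 : Differentiable ℝ (fderiv ℝ χ') :=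
      (hχd.fderiv_right (m := 1) (by norm_cast)).differentiable (by norm_num)
    set ω' : ℂ → ℂ →L[ℝ] ℂ := fun z => (1 - χ' z) • ω z - F z • fderiv ℝ χ' z with hω'
    -- the factor `1 - χ` kills the unknown value of `ω` at the puncture
    have near : ∀ z, dist z s < ε / 3 → ω' =ᶠ[𝓝 z] 0 := by
      intro z hz
      have h1 : ∀ y, dist y s < ε / 3 → χ' =ᶠ[𝓝 y] fun _ => 1 := by
        intro y hy
        filter_upwards [χ.eventuallyEq_one_of_mem_ball (x := y) hy] with w hw
        simp [hχ', hw]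
      have h2 : ∀ᶠ y in 𝓝 z, dist y s < ε / 3 := Metric.isOpen_ball.mem_nhds hz
      filter_upwards [h2] with y hy
      have h3 := (h1 y hy).self_of_nhds
      ext v
      simp [hω', (h1 y hy).fderiv_eq, h3]
    have far : ∀ z, ε / 2 < dist z s → ω' =ᶠ[𝓝 z] ω := by
      intro z hz
      have h2 : ∀ᶠ y in 𝓝 z, ε / 2 < dist y s :=
        (isOpen_lt continuous_const (continuous_id.dist continuous_const)).mem_nhds hz
      have h1 : ∀ y, ε / 2 < dist y s → χ' y = 0 := by
        intro y hy
        simp [hχ', χ.zero_of_le_dist hy.le]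
      filter_upwards [h2, h2.eventually_nhds] with y hy hy'
      have h3 : χ' =ᶠ[𝓝 y] fun _ => 0 := hy'.mono fun w hw => h1 w hw
      simp [hω', h3.fderiv_eq, h1 y hy]
    obtain ⟨P, hP⟩ := ih ω' (by
      intro z hz
      by_cases h1 : dist z s < ε / 3
      · refine ClosedAt.congr ⟨?_, ?_⟩ (near z h1)
        · exact differentiableAt_const 0
        · intro u v
          have : fderiv ℝ (0 : ℂ → ℂ →L[ℝ] ℂ) z = 0 := fderiv_const_apply 0
          simp [this]
      · have hzs : z ≠ s := by rintro rfl; simp at h1; linarith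
        have hcz := hc z (by simp [hzs, hz])
        by_cases h2 : ε / 2 < dist z s
        · exact hcz.congr (far z h2)
        · have h3 : dist z s < ε := by linarith
          have h4 : ∀ᶠ y in 𝓝 z, HasFDerivAt F (ω y) y := by
            have a1 : ∀ᶠ y in 𝓝 z, dist y s < ε := Metric.isOpen_ball.mem_nhds h3
            have a2 : ∀ᶠ y in 𝓝 z, y ≠ s := isOpen_ne.mem_nhds hzs
            filter_upwards [a1, a2] with y y1 y2
            exact (hε y1).1 y2
          -- on the part of the disc that remains, the new form is the differential of `(1 - χ) F`
          refine ClosedAt.of_primitive (P := fun y => (1 - χ' y) * F y) ?_ ?_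
          · exact ((((differentiableAt_const _).sub
              (hχd.differentiable (by norm_num) z)).smul hcz.1)).sub
              ((h4.self_of_nhds).differentiableAt.smul (hχd2 z))
          · filter_upwards [h4] with y hy
            have a := ((hχd.differentiable (by norm_num) y).hasFDerivAt.const_sub 1).mul hy
            refine a.congr_fderiv ?_
            simp [hω', sub_eq_add_neg])
      (by
        intro t ht
        obtain ⟨F', hF'⟩ := he t (by simp [ht])
        have h2 : ε / 2 < dist t s := by
          by_contra h
          exact (hε (y := t) (by linarith)).2 ht
        exact ⟨F', by
          filter_upwards [hF', (far t h2).filter_mono nhdsWithin_le_nhds] with y hy e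
          rwa [e]⟩)
    refine ⟨P, ?_⟩
    have : ∀ᶠ z in Bornology.cobounded ℂ, ε / 2 < dist z s := by
      have := Bornology.isBounded_def.1 (Metric.isBounded_closedBall (x := s) (r := ε / 2))
      filter_upwards [this] with z hz
      simpa using hz
    filter_upwards [hP, this] with z hz h2
    have := (far z h2).self_of_nhds
    rwa [this] at hz

/-- The contour integral `oint` as the integral of a 1-form along the circle. -/
lemma oint_eq_integral {f h : ℂ → ℂ} {r : ℝ} (hr : 0 < r)
    (hf : ∀ w, ‖w‖ = r → ContinuousAt f w) (hh : ∀ w, ‖w‖ = r → ContinuousAt h w) :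
    oint f h r = (2 * (Real.pi : ℂ) * Complex.I)⁻¹ *
      ∫ θ in (0 : ℝ)..2 * Real.pi,
        form (f (circleMap 0 r θ)) (h (circleMap 0 r θ)) (circleMap 0 r θ * Complex.I) := by
  have nr : ∀ θ, ‖circleMap 0 r θ‖ = r := fun θ => by simp [circleMap, abs_of_pos hr]
  have cf : Continuous fun θ => f (circleMap 0 r θ) := continuous_iff_continuousAt.2 fun θ =>
    (hf _ (nr θ)).comp (f := circleMap 0 r) (continuous_circleMap 0 r).continuousAt
  have ch : Continuous fun θ => h (circleMap 0 r θ) := continuous_iff_continuousAt.2 fun θ =>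
    (hh _ (nr θ)).comp (f := circleMap 0 r) (continuous_circleMap 0 r).continuousAt
  have cc := continuous_circleMap 0 r
  have cc' : Continuous fun θ => conj (circleMap 0 r θ) := Complex.continuous_conj.comp cc
  have ch' : Continuous fun θ => conj (h (circleMap 0 r θ)) := Complex.continuous_conj.comp ch
  unfold oint circleIntegral
  congr 1
  rw [intervalIntegral.integral_of_le (by positivity), intervalIntegral.integral_of_le (by positivity),
    intervalIntegral.integral_of_le (by positivity), ← integral_conj, ← MeasureTheory.integral_add]
  · congr 1
    ext θ
    simp
    ring
  · simp only [deriv_circleMap, smul_eq_mul]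
    exact (intervalIntegrable_iff_integrableOn_Ioc_of_le (by positivity)).1
      (Continuous.intervalIntegrable ((cc.mul continuous_const).mul cf) _ _)
  · simp only [deriv_circleMap, smul_eq_mul, map_mul, Complex.conj_conj]
    exact (intervalIntegrable_iff_integrableOn_Ioc_of_le (by positivity)).1
      (Continuous.intervalIntegrable ((cc'.mul continuous_const).mul ch) _ _)

/-- A property of all points of a punctured neighbourhood of `0` holds on all small circles. -/
lemma eventually_circle {p : ℂ → Prop} (hp : ∀ᶠ w in 𝓝[≠] (0 : ℂ), p w) :
    ∀ᶠ r : ℝ in 𝓝[>] 0, ∀ w : ℂ, ‖w‖ = r → p w := by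
  obtain ⟨ε, ε0, hε⟩ := Metric.eventually_nhds_iff.1 (eventually_nhdsWithin_iff.1 hp)
  filter_upwards [Ioo_mem_nhdsGT ε0] with r hr w hw
  refine hε (by simpa [hw] using hr.2) ?_
  rintro rfl
  simp at hw
  exact hr.1.ne hw

/-- The integral of an exact 1-form over a circle vanishes, by the fundamental theorem of calculus. -/
theorem ExactNear.oint_eq_zero {f h : ℂ → ℂ}
    (hf : ∀ᶠ w in 𝓝[≠] (0 : ℂ), ContinuousAt f w) (hh : ∀ᶠ w in 𝓝[≠] (0 : ℂ), ContinuousAt h w)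
    (he : ExactNear (fun w => form (f w) (h w)) 0) : ∀ᶠ r : ℝ in 𝓝[>] 0, oint f h r = 0 := by
  obtain ⟨P, hP⟩ := he
  filter_upwards [eventually_circle hf, eventually_circle hh, eventually_circle hP,
    self_mem_nhdsWithin] with r hf hh hP hr
  rw [oint_eq_integral hr hf hh]
  have nr : ∀ θ, ‖circleMap 0 r θ‖ = r := fun θ => by simp [circleMap, abs_of_pos (Set.mem_Ioi.1 hr)]
  have cf : Continuous fun θ => f (circleMap 0 r θ) := continuous_iff_continuousAt.2 fun θ =>
    (hf _ (nr θ)).comp (f := circleMap 0 r) (continuous_circleMap 0 r).continuousAt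
  have ch : Continuous fun θ => h (circleMap 0 r θ) := continuous_iff_continuousAt.2 fun θ =>
    (hh _ (nr θ)).comp (f := circleMap 0 r) (continuous_circleMap 0 r).continuousAt
  have cc := continuous_circleMap 0 r
  rw [intervalIntegral.integral_eq_sub_of_hasDerivAt (f := fun θ => P (circleMap 0 r θ))]
  · simp [circleMap]
  · intro θ _
    exact (hP _ (nr θ)).comp_hasDerivAt θ (hasDerivAt_circleMap 0 r θ)
  · simp only [form_apply]
    have cc' : Continuous fun θ => conj (circleMap 0 r θ * Complex.I) :=
      Complex.continuous_conj.comp (by fun_prop)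
    exact ((cf.mul (cc.mul continuous_const)).add (ch.mul cc')).intervalIntegrable _ _

/-- The local Poincaré lemma. -/
lemma exists_primitive_nhds {ω : ℂ → ℂ →L[ℝ] ℂ} {z : ℂ} (hc : ∀ᶠ y in 𝓝 z, ClosedAt ω y) :
    ∃ P : ℂ → ℂ, ∀ᶠ y in 𝓝 z, HasFDerivAt P (ω y) y := by
  obtain ⟨ε, ε0, hε⟩ := Metric.eventually_nhds_iff_ball.1 hc
  obtain ⟨P, hP⟩ := (convex_ball z ε).exists_forall_hasFDerivAt_of_fderiv_symmetric
    Metric.isOpen_ball (fun y hy => (hε y hy).1.differentiableWithinAt) (fun y hy => (hε y hy).2)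
  exact ⟨P, Metric.eventually_nhds_iff_ball.2 ⟨ε, ε0, hP⟩⟩

/-- A closed 1-form on a punctured disc whose integrals over circles vanish is exact: its pullback
under `exp` has a primitive on a half plane, which is `2πi`-periodic. -/
theorem exactNear_of_oint_eq_zero {f h : ℂ → ℂ}
    (hf : ∀ᶠ w in 𝓝[≠] (0 : ℂ), ContinuousAt f w) (hh : ∀ᶠ w in 𝓝[≠] (0 : ℂ), ContinuousAt h w)
    (hc : ∀ᶠ w in 𝓝[≠] (0 : ℂ), ClosedAt (fun w => form (f w) (h w)) w)
    (h0 : ∀ᶠ r : ℝ in 𝓝[>] 0, oint f h r = 0) : ExactNear (fun w => form (f w) (h w)) 0 := by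
  set ω : ℂ → ℂ →L[ℝ] ℂ := fun w => form (f w) (h w) with hω
  obtain ⟨ε, ε0, hε⟩ := Metric.eventually_nhds_iff.1 (eventually_nhdsWithin_iff.1 hc)
  set U : Set ℂ := {s | s.re < Real.log ε} with hU
  have Uo : IsOpen U := isOpen_lt Complex.continuous_re continuous_const
  have Uc : Convex ℝ U := convex_halfSpace_re_lt _
  have expU : ∀ s ∈ U, ClosedAt ω (Complex.exp s) := by
    intro s hs
    refine hε ?_ (Complex.exp_ne_zero s)
    rw [dist_zero_right, Complex.norm_exp]
    exact (Real.lt_log_iff_exp_lt ε0).1 hs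
  set θ : ℂ → ℂ →L[ℝ] ℂ := fun s =>
    (ω (Complex.exp s)).comp (ContinuousLinearMap.mul ℝ ℂ (Complex.exp s)) with hθ
  have hexp : ∀ s, HasFDerivAt Complex.exp (ContinuousLinearMap.mul ℝ ℂ (Complex.exp s)) s := by
    intro s
    refine ((Complex.hasDerivAt_exp s).hasFDerivAt.restrictScalars ℝ).congr_fderiv ?_
    ext v
    simp [mul_comm]
  have hθc : ∀ s ∈ U, ClosedAt θ s := by
    intro s hs
    have ev : ∀ᶠ y in 𝓝 (Complex.exp s), ClosedAt ω y := by
      have h1 : ∀ᶠ y in 𝓝 (Complex.exp s), y ≠ 0 := isOpen_ne.mem_nhds (Complex.exp_ne_zero s)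
      have h2 : ∀ᶠ y in 𝓝 (Complex.exp s), dist y 0 < ε := by
        refine Metric.isOpen_ball.mem_nhds (x := Complex.exp s) ?_
        rw [Metric.mem_ball, dist_zero_right, Complex.norm_exp]
        exact (Real.lt_log_iff_exp_lt ε0).1 hs
      filter_upwards [h1, h2] with y h1 h2 using hε h2 h1
    obtain ⟨P, hP⟩ := exists_primitive_nhds ev
    refine ClosedAt.of_primitive (P := P ∘ Complex.exp) ?_ ?_
    · have h1 : DifferentiableAt ℝ (fun s => ω (Complex.exp s)) s :=
        (expU s hs).1.comp s (hexp s).differentiableAt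
      have h2 : DifferentiableAt ℝ (fun s => ContinuousLinearMap.mul ℝ ℂ (Complex.exp s)) s :=
        (ContinuousLinearMap.mul ℝ ℂ).differentiableAt.comp s (hexp s).differentiableAt
      exact h1.clm_comp h2
    · filter_upwards [Complex.continuous_exp.continuousAt.eventually hP] with y hy
      exact hy.comp y (hexp y)
  obtain ⟨P, hP⟩ := Uc.exists_forall_hasFDerivAt_of_fderiv_symmetric Uo
    (fun s hs => (hθc s hs).1.differentiableWithinAt) (fun s hs => (hθc s hs).2)
  have hper : ∀ s, s + 2 * Real.pi * Complex.I ∈ U ↔ s ∈ U := by simp [hU]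
  have hexpper : ∀ s, Complex.exp (s + 2 * Real.pi * Complex.I) = Complex.exp s :=
    Complex.exp_periodic
  have hconst : ∀ s ∈ U, ∀ t ∈ U, P (s + 2 * Real.pi * Complex.I) - P s =
      P (t + 2 * Real.pi * Complex.I) - P t := by
    have hd : ∀ s ∈ U, HasFDerivAt (fun s => P (s + 2 * Real.pi * Complex.I) - P s)
        (0 : ℂ →L[ℝ] ℂ) s := by
      intro s hs
      have h1 := (hP _ ((hper s).2 hs)).comp s ((hasFDerivAt_id (𝕜 := ℝ) s).add_const
        (2 * Real.pi * Complex.I))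
      refine (h1.sub (hP s hs)).congr_fderiv ?_
      simp [hθ, hexpper]
    intro s hs t ht
    exact Uo.is_const_of_fderiv_eq_zero Uc.isPreconnected
      (fun x hx => (hd x hx).differentiableAt.differentiableWithinAt)
      (fun x hx => (hd x hx).fderiv) hs ht
  -- the additive period of the primitive is the integral over a small circle
  have hzero : ∀ s ∈ U, P (s + 2 * Real.pi * Complex.I) = P s := by
    obtain ⟨r, hr, hfr, hhr, r0, rε⟩ := (h0.and ((eventually_circle hf).and
      ((eventually_circle hh).and (Ioo_mem_nhdsGT ε0)))).exists
    have nr : ∀ t, ‖circleMap 0 r t‖ = r := fun t => by simp [circleMap, abs_of_pos r0]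
    have hcm : ∀ t : ℝ, circleMap 0 r t = Complex.exp (Real.log r + t * Complex.I) := by
      intro t
      rw [Complex.exp_add, ← Complex.ofReal_exp, Real.exp_log r0, circleMap_zero]
    have hsU : ∀ t : ℝ, (Real.log r + t * Complex.I : ℂ) ∈ U := by
      intro t
      simpa [hU] using Real.log_lt_log r0 rε
    have cf : Continuous fun θ => f (circleMap 0 r θ) := continuous_iff_continuousAt.2 fun θ =>
      (hfr _ (nr θ)).comp (f := circleMap 0 r) (continuous_circleMap 0 r).continuousAt
    have ch : Continuous fun θ => h (circleMap 0 r θ) := continuous_iff_continuousAt.2 fun θ =>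
      (hhr _ (nr θ)).comp (f := circleMap 0 r) (continuous_circleMap 0 r).continuousAt
    have cc := continuous_circleMap 0 r
    have cc' : Continuous fun θ => conj (circleMap 0 r θ * Complex.I) :=
      Complex.continuous_conj.comp (by fun_prop)
    have key := intervalIntegral.integral_eq_sub_of_hasDerivAt (a := 0) (b := 2 * Real.pi)
      (f := fun t : ℝ => P (Real.log r + t * Complex.I))
      (f' := fun t => form (f (circleMap 0 r t)) (h (circleMap 0 r t))
        (circleMap 0 r t * Complex.I)) (by
        intro t _
        have h1 : HasDerivAt (fun t : ℝ => (Real.log r + t * Complex.I : ℂ)) Complex.I t := by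
          simpa using ((hasDerivAt_id t).ofReal_comp.mul_const Complex.I).const_add
            (Real.log r : ℂ)
        have h2 := (hP _ (hsU t)).comp_hasDerivAt t h1
        rw [hcm]
        exact h2) (by
        simp only [form_apply]
        exact ((cf.mul (cc.mul continuous_const)).add (ch.mul cc')).intervalIntegrable _ _)
    rw [oint_eq_integral r0 hfr hhr, key] at hr
    have h3 : P (Real.log r + 2 * Real.pi * Complex.I) - P (Real.log r) = 0 := by
      have : (2 * (Real.pi : ℂ) * Complex.I)⁻¹ ≠ 0 := by
        simp [Real.pi_ne_zero]
      simpa [this] using hr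
    intro s hs
    have h4 := hconst s hs (Real.log r) (by simpa using hsU 0)
    rw [h3] at h4
    exact sub_eq_zero.1 h4
  classical
  have hperZ : ∀ s ∈ U, ∀ n : ℤ, P (s + n * (2 * Real.pi * Complex.I)) = P s := by
    -- the primitive is only defined on a half plane; extended by zero it is still periodic
    have hp : Function.Periodic (fun s => if s ∈ U then P s else 0) (2 * Real.pi * Complex.I) := by
      intro s
      by_cases hs : s ∈ U
      · simp [hs, (hper s).2 hs, hzero s hs]
      · simp [hs, mt (hper s).1 hs]
    intro s hs n
    have h1 := hp.int_mul n s
    have h2 : s + n * (2 * Real.pi * Complex.I) ∈ U := by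
      simpa [hU] using hs
    simpa [hs, h2] using h1
  refine ⟨fun w => P (Complex.log w), eventually_nhdsWithin_iff.2 (Metric.eventually_nhds_iff.2
    ⟨ε, ε0, fun {w₀} hw hw0 => ?_⟩)⟩
  have hw0 : w₀ ≠ 0 := hw0
  have hsU : Complex.log w₀ ∈ U := by
    rw [dist_zero_right] at hw
    simpa [hU, Complex.log_re] using Real.log_lt_log (norm_pos_iff.2 hw0) hw
  -- a branch of the logarithm near `w₀`
  set l : ℂ → ℂ := fun w => Complex.log w₀ + Complex.log (w / w₀) with hl
  have hld : HasDerivAt l w₀⁻¹ w₀ := by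
    have h1 : HasDerivAt (fun w : ℂ => w / w₀) (1 / w₀) w₀ := (hasDerivAt_id w₀).div_const w₀
    have h2 := h1.clog (by simp [hw0])
    exact (h2.const_add (Complex.log w₀)).congr_deriv (by simp [hw0])
  have hl0 : l w₀ = Complex.log w₀ := by simp [hl, hw0]
  have hlexp : ∀ w, w ≠ 0 → Complex.exp (l w) = w := by
    intro w hw
    rw [hl, Complex.exp_add, Complex.exp_log hw0, Complex.exp_log (div_ne_zero hw hw0)]
    field_simp
  have hev : (fun w => P (Complex.log w)) =ᶠ[𝓝 w₀] P ∘ l := by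
    have h1 : ∀ᶠ w in 𝓝 w₀, w ≠ 0 := isOpen_ne.mem_nhds hw0
    have h2 : ∀ᶠ w in 𝓝 w₀, l w ∈ U :=
      hld.continuousAt.eventually (Uo.mem_nhds (by rwa [hl0]))
    filter_upwards [h1, h2] with w h1 h2
    obtain ⟨n, hn⟩ := Complex.exp_eq_exp_iff_exists_int.1
      ((Complex.exp_log h1).trans (hlexp w h1).symm)
    rw [hn, hperZ _ h2 n, Function.comp_apply]
  have hd : HasFDerivAt P (θ (l w₀)) (l w₀) := hP _ (by rwa [hl0])
  refine ((hd.comp w₀ (hld.hasFDerivAt.restrictScalars ℝ)).congr_of_eventuallyEq hev).congr_fderiv ?_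
  ext1 v
  have : w₀ * (v * w₀⁻¹) = v := by field_simp
  simp [hθ, hlexp w₀ hw0, this]

/-! ### Möbius coordinates and configurations -/

lemma coe_shift (x : ℂ) : (shift x : Matrix (Fin 2) (Fin 2) ℂ) = !![1, x; 0, 1] := rfl

lemma coe_dil (s : ℂ) : (dil s : Matrix (Fin 2) (Fin 2) ℂ) =
    !![Complex.exp (s / 2), 0; 0, Complex.exp (-(s / 2))] := rfl

lemma coe_special (x : ℂ) : (special x : Matrix (Fin 2) (Fin 2) ℂ) = !![1, 0; x, 1] := rfl

/-- The inversion `ζ ↦ -1/ζ`, a Möbius coordinate centred at infinity. -/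
def inversion : Frame := ⟨!![0, -1; 1, 0], by simp⟩

lemma coe_inversion : (inversion : Matrix (Fin 2) (Fin 2) ℂ) = !![0, -1; 1, 0] := rfl

lemma Frame.center_eq (g : Frame) :
    g.center = if g 1 1 = 0 then OnePoint.infty else ((g 0 1 / g 1 1 : ℂ) : OnePoint ℂ) := by
  simp [Frame.center, OnePoint.smul_some_eq_ite]

lemma Frame.center_mul (h g : Frame) :
    (h * g).center = (h : GL (Fin 2) ℂ) • g.center := by
  simp [Frame.center, mul_smul]

lemma Frame.center_mul_left_iff (h : Frame) {g g' : Frame} :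
    (h * g).center = (h * g').center ↔ g.center = g'.center := by
  rw [center_mul, center_mul, smul_left_cancel_iff]

lemma center_shift (x : ℂ) : (shift x).center = (x : OnePoint ℂ) := by
  simp [Frame.center_eq, coe_shift]

lemma shift_add (x y : ℂ) : shift (x + y) = shift x * shift y := by
  ext i j; fin_cases i <;> fin_cases j <;> simp [coe_shift, add_comm]

lemma shift_zero : shift 0 = 1 := by
  ext i j; fin_cases i <;> fin_cases j <;> simp [coe_shift]

lemma dil_add (x y : ℂ) : dil (x + y) = dil x * dil y := by
  ext i j; fin_cases i <;> fin_cases j <;> simp [coe_dil, ← Complex.exp_add] <;> ring_nf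

lemma special_add (x y : ℂ) : special (x + y) = special x * special y := by
  ext i j; fin_cases i <;> fin_cases j <;> simp [coe_special]

lemma dil_zero : dil 0 = 1 := by
  ext i j; fin_cases i <;> fin_cases j <;> simp [coe_dil]

lemma special_zero : special 0 = 1 := by
  ext i j; fin_cases i <;> fin_cases j <;> simp [coe_special]

lemma Frame.center_mul_dil (g : Frame) (x : ℂ) : (g * dil x).center = g.center := by
  conv_rhs => rw [← mul_one g]
  rw [Frame.center_mul_left_iff]
  simp [Frame.center_eq, coe_dil]

lemma Frame.center_mul_special (g : Frame) (x : ℂ) : (g * special x).center = g.center := by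
  conv_rhs => rw [← mul_one g]
  rw [Frame.center_mul_left_iff]
  simp [Frame.center_eq, coe_special]

/-- A Möbius coordinate centred at a finite point is obtained from the standard coordinate there
by a dilation and a special conformal transformation. -/
lemma Frame.exists_eq_shift_mul (N : Frame) (hN : N 1 1 ≠ 0) :
    ∃ s x : ℂ, Complex.exp s = (N 1 1 ^ 2)⁻¹ ∧
      N = shift (N 0 1 / N 1 1) * dil s * special x := by
  have hdet : N 0 0 * N 1 1 - N 0 1 * N 1 0 = 1 := by
    rw [← Matrix.det_fin_two]; exact N.2
  have h1 : Complex.exp (Complex.log (N 1 1)) = N 1 1 := Complex.exp_log hN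
  refine ⟨-(2 * Complex.log (N 1 1)), N 1 0 / N 1 1, ?_, ?_⟩
  · rw [Complex.exp_neg, two_mul, Complex.exp_add, h1, sq]
  · have h2 : Complex.exp (-(2 * Complex.log (N 1 1)) / 2) = (N 1 1)⁻¹ := by
      rw [show -(2 * Complex.log (N 1 1)) / 2 = -Complex.log (N 1 1) by ring, Complex.exp_neg, h1]
    have h3 : Complex.exp (-(-(2 * Complex.log (N 1 1)) / 2)) = N 1 1 := by
      rw [show -(-(2 * Complex.log (N 1 1)) / 2) = Complex.log (N 1 1) by ring, h1]
    ext i j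
    fin_cases i <;> fin_cases j <;>
      simp [coe_shift, coe_dil, coe_special, h2, h3] <;> field_simp
    linear_combination hdet

lemma separated_cons {n : ℕ} {h : Frame} {g : Fin n → Frame} :
    Separated (vecCons h g) ↔ Separated g ∧ ∀ i, h.center ≠ (g i).center := by
  constructor
  · intro H
    refine ⟨fun i j hij => ?_, fun i hi => ?_⟩
    · exact Fin.succ_injective _ (@H i.succ j.succ (by simpa using hij))
    · exact (Fin.succ_ne_zero i).symm (@H 0 i.succ (by simpa using hi))
  · rintro ⟨H, h0⟩ i j
    refine Fin.cases ?_ (fun i => ?_) i <;> refine Fin.cases ?_ (fun j => ?_) j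
    · simp
    · intro hij; exact absurd (by simpa using hij) (h0 j)
    · intro hij; exact absurd (by simpa using hij.symm) (h0 i)
    · intro hij; exact congrArg Fin.succ (H (by simpa using hij))

lemma Separated.comp_injective {m n : ℕ} {g : Fin n → Frame} (hg : Separated g) {σ : Fin m → Fin n}
    (hσ : Function.Injective σ) : Separated (g ∘ σ) :=
  Function.Injective.comp hg hσ

lemma separated_congr {n : ℕ} {g g' : Fin n → Frame} (h : ∀ i, (g i).center = (g' i).center) :
    Separated g ↔ Separated g' := by
  simp [Separated, h]

lemma Separated.mul_left {n : ℕ} {g : Fin n → Frame} (hg : Separated g) (h : Frame) :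
    Separated fun i => h * g i :=
  fun _ _ hij => hg ((h.center_mul_left_iff).1 hij)

lemma separated_update_of_center_eq {n : ℕ} {g : Fin n → Frame} {i : Fin n} {h : Frame}
    (hh : h.center = (g i).center) : Separated (Function.update g i h) ↔ Separated g := by
  refine separated_congr fun j => ?_
  by_cases hj : j = i
  · subst hj; simp [hh]
  · simp [hj]

/-- In any coordinate, all but finitely many points differ from the points of a configuration. -/
lemma finite_not_separated {n : ℕ} {g : Fin n → Frame} (hg : Separated g) (k : Frame) :
    {w : ℂ | ¬ Separated (vecCons (k * shift w) g)}.Finite := by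
  have h1 : {w : ℂ | ¬ Separated (vecCons (k * shift w) g)} ⊆
      ⋃ i, {w : ℂ | (k * shift w).center = (g i).center} := by
    intro w hw
    simpa [separated_cons, hg] using hw
  refine (Set.finite_iUnion fun i => ?_).subset h1
  refine Set.Subsingleton.finite fun w hw w' hw' => ?_
  have h2 : (k * shift w).center = (k * shift w').center := hw.trans hw'.symm
  rw [Frame.center_mul_left_iff, center_shift, center_shift] at h2
  exact OnePoint.coe_injective h2

lemma eventually_separated {n : ℕ} {g : Fin n → Frame} (hg : Separated g) (k : Frame) (z : ℂ) :
    ∀ᶠ w in 𝓝[≠] z, Separated (vecCons (k * shift w) g) := by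
  have h := ((finite_not_separated hg k).sdiff (t := {z})).isClosed.isOpen_compl
  have h2 := h.mem_nhds (x := z) (by simp)
  rw [eventually_nhdsWithin_iff]
  filter_upwards [h2] with w hw hwz
  by_contra hs
  exact hw ⟨hs, hwz⟩

lemma update_vecCons_zero {α : Type*} {n : ℕ} (a b : α) (v : Fin n → α) :
    Function.update (vecCons a v) 0 b = vecCons b v := by
  ext i; refine Fin.cases ?_ (fun i => ?_) i <;> simp

lemma vecCons_comp_swap {α : Type*} {n : ℕ} (a : α) (v : Fin (n + 1) → α) (i : Fin (n + 1)) :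
    vecCons a (v ∘ Equiv.swap 0 i) = vecCons a v ∘ Equiv.swap 1 i.succ := by
  ext j
  refine Fin.cases ?_ (fun j => ?_) j
  · rw [Function.comp_apply, Equiv.swap_apply_of_ne_of_ne (by simp) (Fin.succ_ne_zero i).symm]
    simp
  · have : Equiv.swap (1 : Fin (n + 2)) i.succ j.succ = (Equiv.swap 0 i j).succ := by
      rw [← Fin.succ_zero_eq_one]
      exact (Fin.succ_injective _).swap_apply _ _ _
    simp [this]

/-! ### Correlators of a conformal field theory -/

namespace SphereCFT

variable {V : Type*} [AddCommGroup V] [Module ℂ V] (C : SphereCFT V)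

/-- Permuting homogeneous fields multiplies a correlator by a nonzero constant, which depends on
the degrees only. -/
lemma corr_perm {n : ℕ} (σ : Equiv.Perm (Fin (n + 1))) (d : Fin (n + 1) → ℤ) :
    ∃ ε : ℂ, ε ≠ 0 ∧ ∀ (g : Fin (n + 1) → Frame) (Φ : Fin (n + 1) → V), Separated g →
      (∀ i, Φ i ∈ C.gr (d i)) → C.corr (n + 1) (g ∘ σ) (Φ ∘ σ) = ε * C.corr (n + 1) g Φ := by
  have hσ : σ ∈ Submonoid.closure
      (Set.range fun i : Fin n => Equiv.swap i.castSucc i.succ) := by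
    rw [Equiv.Perm.mclosure_swap_castSucc_succ]; trivial
  induction hσ using Submonoid.closure_induction generalizing d with
  | mem σ h =>
    obtain ⟨i, rfl⟩ := h
    exact ⟨_, zpow_ne_zero _ (by norm_num), fun g Φ hg hΦ =>
      C.corr_swap n i g Φ (d i.castSucc) (d i.succ) hg (hΦ _) (hΦ _)⟩
  | one => exact ⟨1, one_ne_zero, fun g Φ _ _ => by simp⟩
  | mul σ τ _ _ hσ hτ =>
    obtain ⟨a, a0, ha⟩ := hσ d
    obtain ⟨b, b0, hb⟩ := hτ (d ∘ σ)
    refine ⟨b * a, mul_ne_zero b0 a0, fun g Φ hg hΦ => ?_⟩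
    have := hb (g ∘ σ) (Φ ∘ σ) (hg.comp_injective σ.injective) fun i => hΦ _
    rw [ha g Φ hg hΦ, ← mul_assoc] at this
    exact this

/-- Along a one-parameter group of coordinate changes that fix the centre, a correlator which
satisfies a linear differential equation is an exponential. -/
lemma corr_flow {m : ℂ → Frame} (hm : ∀ a b, m (a + b) = m a * m b) (hm0 : m 0 = 1)
    (hcen : ∀ (k : Frame) a, (k * m a).center = k.center) {n : ℕ} {Φ : Fin n → V} {i : Fin n}
    {x c : ℂ}
    (hd : ∀ g : Fin n → Frame, Separated g →
      HasDerivAt (fun t : ℝ => C.corr n (Function.update g i (g i * m (t * x))) Φ)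
        (c * C.corr n g Φ) 0)
    {g : Fin n → Frame} (hg : Separated g) :
    C.corr n (Function.update g i (g i * m x)) Φ = Complex.exp c * C.corr n g Φ := by
  set φ : ℝ → ℂ := fun t => C.corr n (Function.update g i (g i * m (t * x))) Φ with hφ
  have h1 : ∀ t, HasDerivAt φ (c * φ t) t := by
    intro t₀
    have h2 := hd (Function.update g i (g i * m (t₀ * x)))
      ((separated_update_of_center_eq (hcen _ _)).2 hg)
    rw [← sub_self t₀] at h2
    have h3 := h2.comp_sub_const t₀ t₀
    have h4 : ∀ t : ℝ, (t₀ * x + ((t - t₀ : ℝ) : ℂ) * x : ℂ) = t * x := fun t => by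
      push_cast; ring
    simpa only [Function.update_self, Function.update_idem, mul_assoc, ← hm, h4] using h3
  -- uniqueness of the solution of `φ' = c φ`
  have h4 : ∀ t, HasDerivAt (fun t : ℝ => Complex.exp (-(t * c)) * φ t) 0 t := by
    intro t
    have h5 : HasDerivAt (fun t : ℝ => Complex.exp (-(t * c))) (Complex.exp (-(t * c)) * -c) t := by
      have := (((hasDerivAt_id t).ofReal_comp.mul_const c).neg).cexp
      simpa using this
    refine (h5.mul (h1 t)).congr_deriv ?_
    ring
  have h6 := is_const_of_deriv_eq_zero (fun t => (h4 t).differentiableAt)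
    (fun t => (h4 t).deriv) 1 0
  simp only [hφ, Complex.ofReal_one, one_mul, Complex.ofReal_zero, zero_mul, neg_zero,
    Complex.exp_zero, hm0, mul_one, Function.update_eq_self] at h6
  rw [← h6, ← mul_assoc, ← Complex.exp_add]
  simp

/-- A correlator does not see special conformal changes of the coordinate of the field `Φ i` if
correlators of `L₁ Φ i` and `L̄₁ Φ i` vanish. -/
lemma corr_mul_special {n : ℕ} {Φ : Fin n → V} {i : Fin n}
    (h1 : ∀ g, Separated g → C.corr n g (Function.update Φ i (C.L 1 (Φ i))) = 0)
    (h1b : ∀ g, Separated g → C.corr n g (Function.update Φ i (C.Lbar 1 (Φ i))) = 0)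
    {g : Fin n → Frame} (hg : Separated g) (x : ℂ) :
    C.corr n (Function.update g i (g i * special x)) Φ = C.corr n g Φ := by
  have := C.corr_flow (x := x) (c := 0) (Φ := Φ) (i := i) special_add special_zero
    Frame.center_mul_special
    (fun g hg => (C.corr_special n g Φ i x hg).congr_deriv (by simp [h1 g hg, h1b g hg])) hg
  simpa using this

/-- Under dilations of its coordinate, a field of weight `(k, kb)` scales accordingly. -/
lemma corr_mul_dil {n : ℕ} {Φ : Fin n → V} {i : Fin n} {k kb : ℂ}
    (h0 : ∀ g, Separated g →
      C.corr n g (Function.update Φ i (C.L 0 (Φ i))) = k * C.corr n g Φ)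
    (h0b : ∀ g, Separated g →
      C.corr n g (Function.update Φ i (C.Lbar 0 (Φ i))) = kb * C.corr n g Φ)
    {g : Fin n → Frame} (hg : Separated g) (s : ℂ) :
    C.corr n (Function.update g i (g i * dil s)) Φ =
      Complex.exp (k * s + kb * conj s) * C.corr n g Φ :=
  C.corr_flow (x := s) (c := k * s + kb * conj s) (Φ := Φ) (i := i) dil_add dil_zero
    Frame.center_mul_dil
    (fun g hg => (C.corr_dil n g Φ i s hg).congr_deriv (by rw [h0 g hg, h0b g hg]; ring)) hg

/-- The differential of a correlator in the position of its field `X`. -/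
lemma hasFDerivAt_corr {n : ℕ} {g : Fin n → Frame} {k : Frame} (X : V) (Φ : Fin n → V) {z : ℂ}
    (hz : Separated (vecCons (k * shift z) g)) :
    HasFDerivAt (fun w => C.corr (n + 1) (vecCons (k * shift w) g) (vecCons X Φ))
      (form (C.corr (n + 1) (vecCons (k * shift z) g) (vecCons (C.L (-1) X) Φ))
        (C.corr (n + 1) (vecCons (k * shift z) g) (vecCons (C.Lbar (-1) X) Φ))) z := by
  set ψ : ℂ → ℂ := fun w => C.corr (n + 1) (vecCons (k * shift w) g) (vecCons X Φ) with hψ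
  have h1 := C.corr_smooth (n + 1) _ (vecCons X Φ) hz
  have h2 : DifferentiableAt ℝ ψ z := by
    have h3 : DifferentiableAt ℝ
        (fun w : ℂ => (vecCons (w - z) 0 : Fin (n + 1) → ℂ)) z := by
      refine differentiableAt_pi.2 fun i => ?_
      refine Fin.cases ?_ (fun i => ?_) i
      · simp
      · simp
    have h4 := h1.differentiableAt (by norm_num)
    have h5 : (vecCons (z - z) 0 : Fin (n + 1) → ℂ) = 0 := by
      ext i; refine Fin.cases ?_ (fun i => ?_) i <;> simp
    rw [← h5] at h4
    have h6 := DifferentiableAt.comp z h4 h3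
    have h7 : ∀ w : ℂ, (fun i => vecCons (k * shift z) g i *
        shift ((vecCons (w - z) 0 : Fin (n + 1) → ℂ) i)) = vecCons (k * shift w) g := by
      intro w
      ext1 i
      refine Fin.cases ?_ (fun i => ?_) i
      · simp [mul_assoc, ← shift_add]
      · simp [shift_zero]
    have h8 : ψ = (fun x : Fin (n + 1) → ℂ => C.corr (n + 1)
        (fun i => vecCons (k * shift z) g i * shift (x i)) (vecCons X Φ)) ∘
        fun w : ℂ => (vecCons (w - z) 0 : Fin (n + 1) → ℂ) := by
      ext w
      simp only [Function.comp, h7]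
      rfl
    rw [h8]
    exact h6
  refine h2.hasFDerivAt.congr_fderiv ?_
  ext1 x
  have h7 := C.corr_trans (n + 1) _ (vecCons X Φ) 0 x hz
  simp only [update_vecCons_zero, cons_val_zero] at h7
  have h8 : HasDerivAt (fun t : ℝ => z + t * x) x 0 := by
    simpa using ((hasDerivAt_id (0 : ℝ)).ofReal_comp.mul_const x).const_add z
  have h9 : HasFDerivAt ψ (fderiv ℝ ψ z) (z + (0 : ℝ) * x) := by
    simpa using h2.hasFDerivAt
  have h10 := h9.comp_hasDerivAt 0 h8
  have h11 : (ψ ∘ fun t : ℝ => z + t * x) = fun t : ℝ =>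
      C.corr (n + 1) (vecCons (k * shift z * shift (t * x)) g) (vecCons X Φ) := by
    ext t; simp [hψ, mul_assoc, ← shift_add]
  rw [h11] at h10
  rw [h10.unique h7, form_apply]
  ring

end SphereCFT

/-! ### The current and the Ward identity of the differential -/

namespace SphereTCFT

variable {V : Type*} [AddCommGroup V] [Module ℂ V] (C : SphereTCFT V)

/-- The 1-form `⟨(dw J(w) + dw̄ J̄(w)) Φ 0 ⋯ Φ (n-1)⟩`, in the coordinate `w` given by `k`. -/
noncomputable def currentForm {n : ℕ} (g : Fin n → Frame) (Φ : Fin n → V) (k : Frame) (w : ℂ) :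
    ℂ →L[ℝ] ℂ :=
  form (C.corr (n + 1) (vecCons (k * shift w) g) (vecCons C.J Φ))
    (C.corr (n + 1) (vecCons (k * shift w) g) (vecCons C.Jbar Φ))

lemma corr_cons_zero {n : ℕ} (g : Fin (n + 1) → Frame) (Φ : Fin n → V) :
    C.corr (n + 1) g (vecCons 0 Φ) = 0 :=
  (C.corr (n + 1) g).map_coord_zero 0 rfl

lemma corr_cons_smul {n : ℕ} (g : Fin (n + 1) → Frame) (c : ℂ) (X : V) (Φ : Fin n → V) :
    C.corr (n + 1) g (vecCons (c • X) Φ) = c * C.corr (n + 1) g (vecCons X Φ) := by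
  have := (C.corr (n + 1) g).map_update_smul (vecCons X Φ) 0 c X
  simpa only [update_vecCons_zero, smul_eq_mul] using this

lemma corr_cons_sub {n : ℕ} (g : Fin (n + 1) → Frame) (X Y : V) (Φ : Fin n → V) :
    C.corr (n + 1) g (vecCons (X - Y) Φ) =
      C.corr (n + 1) g (vecCons X Φ) - C.corr (n + 1) g (vecCons Y Φ) := by
  have := (C.corr (n + 1) g).map_update_sub (vecCons X Φ) 0 X Y
  simpa only [update_vecCons_zero] using this

/-- A field that is annihilated by `L₁` and `L̄₁` and has weight `(a, b)` changes by a factor under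
a change of its Möbius coordinate. -/
lemma corr_change_coordinate {n : ℕ} {g : Fin n → Frame} (Φ : Fin n → V) {X : V} {a b : ℂ}
    (hw : C.HasWeight X a b) (h1 : C.L 1 X = 0) (h1b : C.Lbar 1 X = 0) (k : Frame) (s x : ℂ)
    (hs : Separated (vecCons k g)) :
    C.corr (n + 1) (vecCons (k * dil s * special x) g) (vecCons X Φ) =
      Complex.exp (a * s + b * conj s) * C.corr (n + 1) (vecCons k g) (vecCons X Φ) := by
  have hs' : Separated (vecCons (k * dil s) g) := by
    rw [← update_vecCons_zero k (k * dil s)]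
    exact (separated_update_of_center_eq (by simp [Frame.center_mul_dil])).2 hs
  have e1 := C.corr_mul_special (Φ := vecCons X Φ) (i := 0)
    (fun g _ => by simp [update_vecCons_zero, h1, C.corr_cons_zero])
    (fun g _ => by simp [update_vecCons_zero, h1b, C.corr_cons_zero]) hs' x
  have e2 := C.corr_mul_dil (Φ := vecCons X Φ) (i := 0) (k := a) (kb := b)
    (fun g _ => by simp [update_vecCons_zero, hw.1, C.corr_cons_smul])
    (fun g _ => by simp [update_vecCons_zero, hw.2, C.corr_cons_smul]) hs s
  simp only [update_vecCons_zero, cons_val_zero] at e1 e2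
  rw [e1, e2]

/-- The current is a 1-form: if the coordinates of `k * m` and `k` are related by the Möbius
transformation `m`, then primitives of the current in the latter coordinate pull back to primitives
in the former. -/
lemma hasFDerivAt_comp_moebius {n : ℕ} {g : Fin n → Frame} {Φ : Fin n → V} {k m : Frame} {w : ℂ}
    {P : ℂ → ℂ} (hm : m 1 0 * w + m 1 1 ≠ 0) (hs : Separated (vecCons (k * m * shift w) g))
    (hP : HasFDerivAt P
      (C.currentForm g Φ k ((m 0 0 * w + m 0 1) / (m 1 0 * w + m 1 1)))
      ((m 0 0 * w + m 0 1) / (m 1 0 * w + m 1 1))) :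
    HasFDerivAt (fun w => P ((m 0 0 * w + m 0 1) / (m 1 0 * w + m 1 1)))
      (C.currentForm g Φ (k * m) w) w := by
  have hdet : m 0 0 * m 1 1 - m 0 1 * m 1 0 = 1 := by
    rw [← Matrix.det_fin_two]; exact m.2
  have e01 : (m * shift w) 0 1 = m 0 0 * w + m 0 1 := by
    simp [Matrix.mul_apply, Fin.sum_univ_two, coe_shift]
  have e11 : (m * shift w) 1 1 = m 1 0 * w + m 1 1 := by
    simp [Matrix.mul_apply, Fin.sum_univ_two, coe_shift]
  obtain ⟨s, x, hsx, hN⟩ := (m * shift w).exists_eq_shift_mul (by rwa [e11])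
  rw [e01, e11] at hN
  rw [e11] at hsx
  set z := (m 0 0 * w + m 0 1) / (m 1 0 * w + m 1 1) with hz
  have hk : k * m * shift w = k * shift z * dil s * special x := by
    rw [mul_assoc, hN]; simp only [mul_assoc]
  have hs' : Separated (vecCons (k * shift z) g) := by
    rw [separated_cons] at hs ⊢
    simpa [hk, Frame.center_mul_dil, Frame.center_mul_special] using hs
  have hd : HasDerivAt (fun w => (m 0 0 * w + m 0 1) / (m 1 0 * w + m 1 1))
      (Complex.exp s) w := by
    have h1 : HasDerivAt (fun w => m 0 0 * w + m 0 1) (m 0 0) w := by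
      simpa using ((hasDerivAt_id w).const_mul (m 0 0)).add_const (m 0 1)
    have h2 : HasDerivAt (fun w => m 1 0 * w + m 1 1) (m 1 0) w := by
      simpa using ((hasDerivAt_id w).const_mul (m 1 0)).add_const (m 1 1)
    refine (h1.div h2 hm).congr_deriv ?_
    rw [hsx]
    field_simp
    linear_combination hdet
  refine (hP.comp w (hd.hasFDerivAt.restrictScalars ℝ)).congr_fderiv ?_
  ext1 v
  simp only [currentForm, hk]
  rw [C.corr_change_coordinate Φ C.J_weight C.oneForm.1.1 C.oneForm.1.2 _ s x hs',
    C.corr_change_coordinate Φ C.Jbar_weight C.oneForm.2.1 C.oneForm.2.2 _ s x hs']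
  simp [← Complex.exp_conj]
  ring

/-- Conservation of the current. -/
lemma closedAt_currentForm {n : ℕ} {g : Fin n → Frame} (Φ : Fin n → V) {k : Frame} {z : ℂ}
    (hz : Separated (vecCons (k * shift z) g)) : ClosedAt (C.currentForm g Φ k) z := by
  have hA := C.hasFDerivAt_corr C.J Φ hz
  have hB := C.hasFDerivAt_corr C.Jbar Φ hz
  have h1 := (hA.smul_const (ContinuousLinearMap.id ℝ ℂ)).add
    (hB.smul_const (Complex.conjCLE : ℂ →L[ℝ] ℂ))
  have h2 : HasFDerivAt (C.currentForm g Φ k) _ z := h1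
  refine ⟨h2.differentiableAt, fun u v => ?_⟩
  have h3 := C.corr_cons_sub (vecCons (k * shift z) g) (C.Lbar (-1) C.J) (C.L (-1) C.Jbar) Φ
  rw [C.closed, C.corr_cons_zero] at h3
  rw [h2.fderiv]
  simp
  linear_combination (u * conj v - v * conj u) * h3

/-- `Q` acts on the first field of a correlator by the contour integral of the current. -/
lemma corr_Q_eq_oint {n : ℕ} {g : Fin (n + 1) → Frame} (hg : Separated g) (Ψ : V)
    (Φ : Fin n → V) :
    ∀ᶠ r : ℝ in 𝓝[>] 0, C.corr (n + 1) g (vecCons (C.Q Ψ) Φ) =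
      oint (fun w => C.corr (n + 2) (vecCons (g 0 * shift w) g) (vecCons C.J (vecCons Ψ Φ)))
        (fun w => C.corr (n + 2) (vecCons (g 0 * shift w) g)
          (vecCons C.Jbar (vecCons Ψ Φ))) r := by
  have e : g = vecCons (g 0) (fun i => g i.succ) := by
    ext1 i; refine Fin.cases ?_ (fun i => ?_) i <;> simp
  have h := C.corr_Q n (g 0) (fun i => g i.succ) Ψ Φ (by rwa [← e])
  rw [← e] at h
  simp only [SphereCFT.current, ← e] at h
  exact h

lemma eventually_continuousAt_corr {n : ℕ} {g : Fin n → Frame} (hg : Separated g) (k : Frame)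
    (X : V) (Φ : Fin n → V) : ∀ᶠ w in 𝓝[≠] (0 : ℂ),
      ContinuousAt (fun w => C.corr (n + 1) (vecCons (k * shift w) g) (vecCons X Φ)) w := by
  filter_upwards [eventually_separated hg k 0] with w hw
  exact (C.hasFDerivAt_corr X Φ hw).continuousAt

/-- Near a `Q`-closed field the current has no residue, hence a primitive. The field is moved to
the first position in the correlator, at the expense of a constant. -/
lemma exactNear_currentForm {n : ℕ} {g : Fin (n + 1) → Frame} (hg : Separated g)
    {Φ : Fin (n + 1) → V} {d : Fin (n + 1) → ℤ} (hd : ∀ i, Φ i ∈ C.gr (d i)) {i : Fin (n + 1)}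
    (hi : C.Q (Φ i) = 0) : ExactNear (C.currentForm g Φ (g i)) 0 := by
  have hinj : Function.Injective (Equiv.swap 0 i) := (Equiv.swap 0 i).injective
  have hgs := hg.comp_injective hinj
  have e0 : Φ ∘ Equiv.swap 0 i = vecCons (Φ i) (fun j => Φ (Equiv.swap 0 i j.succ)) := by
    ext1 j; refine Fin.cases ?_ (fun j => ?_) j <;> simp
  obtain ⟨P, hP⟩ : ExactNear
      (C.currentForm (g ∘ Equiv.swap 0 i) (Φ ∘ Equiv.swap 0 i) (g i)) 0 := by
    refine exactNear_of_oint_eq_zero (C.eventually_continuousAt_corr hgs _ _ _)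
      (C.eventually_continuousAt_corr hgs _ _ _) ?_ ?_
    · filter_upwards [eventually_separated hgs (g i) 0] with w hw
      exact C.closedAt_currentForm _ hw
    · filter_upwards [C.corr_Q_eq_oint hgs (Φ i) (fun j => Φ (Equiv.swap 0 i j.succ))] with r hr
      rw [hi, C.corr_cons_zero] at hr
      rw [e0]
      simpa using hr.symm
  obtain ⟨ε, ε0, hε⟩ := C.corr_perm (n := n + 1) (Equiv.swap 1 i.succ) (vecCons 1 d)
  refine ⟨fun w => ε⁻¹ * P w, ?_⟩
  filter_upwards [hP, eventually_separated hg (g i) 0] with w hw hs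
  have hJ : ∀ X ∈ C.gr 1, C.corr (n + 2) (vecCons (g i * shift w) (g ∘ Equiv.swap 0 i))
      (vecCons X (Φ ∘ Equiv.swap 0 i)) =
        ε * C.corr (n + 2) (vecCons (g i * shift w) g) (vecCons X Φ) := by
    intro X hX
    rw [vecCons_comp_swap, vecCons_comp_swap]
    refine hε _ _ hs fun j => ?_
    refine Fin.cases ?_ (fun j => ?_) j
    · simpa using hX
    · simpa using hd j
  refine (hw.const_mul ε⁻¹).congr_fderiv ?_
  ext1 v
  simp only [currentForm, hJ _ C.J_mem, hJ _ C.Jbar_mem]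
  simp
  field_simp

/-- The Ward identity, in a coordinate in which the exact field is at infinity. -/
lemma corr_exact_at_infinity {n : ℕ} {g : Fin (n + 1) → Frame} (hg : Separated g)
    (h0 : g 0 = inversion) {Ψ : V} {Φ : Fin n → V} {d : Fin (n + 1) → ℤ}
    (hd : ∀ i, vecCons Ψ Φ i ∈ C.gr (d i)) (hΦ : ∀ i, C.Q (Φ i) = 0) :
    C.corr (n + 1) g (vecCons (C.Q Ψ) Φ) = 0 := by
  set X : Fin (n + 1) → V := vecCons Ψ Φ with hX
  have hfin := finite_not_separated hg 1
  obtain ⟨P, hP⟩ := exists_primitive_near_infinity hfin.toFinset (C.currentForm g X 1)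
    (fun z hz => C.closedAt_currentForm X (by simpa using hz)) (by
      intro z hz
      have hz' : ¬ Separated (vecCons (1 * shift z) g) := by simpa using hz
      rw [separated_cons, not_and] at hz'
      obtain ⟨i, hi⟩ := not_forall.1 (hz' hg)
      rw [not_not, one_mul, center_shift] at hi
      -- the field at infinity is not at the finite point `z`, so a closed field is
      obtain ⟨j, rfl⟩ : ∃ j : Fin n, i = j.succ := by
        refine Fin.exists_succ_eq.2 ?_ |>.imp fun _ h => h.symm
        rintro rfl
        rw [h0, Frame.center_eq] at hi
        simp [coe_inversion] at hi
      obtain ⟨F, hF⟩ := C.exactNear_currentForm hg hd (i := j.succ) (by simpa [hX] using hΦ j)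
      -- the transition from the standard coordinate to the one centred at the puncture
      set m : Frame := (g j.succ)⁻¹ with hm
      have hm0 : m 0 0 * z + m 0 1 = 0 ∧ m 1 0 * z + m 1 1 ≠ 0 := by
        have h1 : (m * shift z).center = (1 : Frame).center := by
          rw [← (g j.succ).center_mul_left_iff, hm, mul_inv_cancel_left, mul_one, center_shift, hi]
        have hdet : m 0 0 * m 1 1 - m 0 1 * m 1 0 = 1 := by
          rw [← Matrix.det_fin_two]; exact m.2
        rw [Frame.center_eq, Frame.center_eq] at h1
        simp [Matrix.mul_apply, Fin.sum_univ_two, coe_shift] at h1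
        by_cases h2 : m 1 0 * z + m 1 1 = 0
        · simp [h2] at h1
        · simp [h2] at h1
          exact ⟨h1, h2⟩
      have hcont : ContinuousAt (fun w => (m 0 0 * w + m 0 1) / (m 1 0 * w + m 1 1)) z :=
        ContinuousAt.div (by fun_prop) (by fun_prop) hm0.2
      have hden : ∀ᶠ w in 𝓝[≠] z, m 1 0 * w + m 1 1 ≠ 0 :=
        nhdsWithin_le_nhds ((ContinuousAt.eventually_ne (by fun_prop) hm0.2))
      have ht : Tendsto (fun w => (m 0 0 * w + m 0 1) / (m 1 0 * w + m 1 1)) (𝓝[≠] z) (𝓝[≠] 0) := by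
        refine tendsto_nhdsWithin_iff.2 ⟨?_, ?_⟩
        · have := hcont.tendsto
          rw [hm0.1, zero_div] at this
          exact this.mono_left nhdsWithin_le_nhds
        · filter_upwards [hden, self_mem_nhdsWithin] with w hw hwz h
          have hdet : m 0 0 * m 1 1 - m 0 1 * m 1 0 = 1 := by
            rw [← Matrix.det_fin_two]; exact m.2
          have h3 : m 0 0 * w + m 0 1 = 0 := by simpa [hw] using h
          have h4 : m 0 0 * (w - z) = 0 := by linear_combination h3 - hm0.1
          have h5 : m 0 0 = 0 := by simpa [sub_ne_zero.2 hwz] using h4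
          have h6 : m 0 1 = 0 := by simpa [h5] using h3
          simp [h5, h6] at hdet
      refine ⟨fun w => F ((m 0 0 * w + m 0 1) / (m 1 0 * w + m 1 1)), ?_⟩
      filter_upwards [ht.eventually hF, hden, eventually_separated hg 1 z] with w hw hd hs
      have e : g j.succ * m = 1 := by simp [hm]
      have := C.hasFDerivAt_comp_moebius (k := g j.succ) (m := m) (w := w) (Φ := X) (P := F) hd
        (by rwa [e]) hw
      rwa [e] at this)
  have hE : ExactNear (C.currentForm g X (g 0)) 0 := by
    have ht : Tendsto (fun w : ℂ => (inversion 0 0 * w + inversion 0 1) /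
        (inversion 1 0 * w + inversion 1 1)) (𝓝[≠] 0) (Bornology.cobounded ℂ) := by
      have := (tendsto_neg_cobounded (E := ℂ)).comp (tendsto_inv₀_nhdsNE_zero (α := ℂ))
      refine this.congr fun w => ?_
      simp [coe_inversion, neg_div]
    refine ⟨fun w => P ((inversion 0 0 * w + inversion 0 1) /
      (inversion 1 0 * w + inversion 1 1)), ?_⟩
    filter_upwards [ht.eventually hP, self_mem_nhdsWithin, eventually_separated hg (g 0) 0]
      with w hw hw0 hs
    have := C.hasFDerivAt_comp_moebius (k := 1) (m := inversion) (w := w) (Φ := X) (P := P)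
      (by simpa [coe_inversion] using hw0) (by rwa [one_mul, ← h0]) hw
    rw [one_mul] at this
    rw [h0]
    exact this
  obtain ⟨r, h1, h2⟩ := ((C.corr_Q_eq_oint hg Ψ Φ).and (hE.oint_eq_zero
    (C.eventually_continuousAt_corr hg _ _ _) (C.eventually_continuousAt_corr hg _ _ _))).exists
  rw [h1, h2]

end SphereTCFT

/-! ### Exact fields among closed fields -/

/-- A multilinear map that vanishes on a product of sets vanishes on the product of their spans. -/
lemma multilinear_eq_zero_of_mem_span {R M N ι : Type*} [CommSemiring R] [AddCommMonoid M]
    [Module R M] [AddCommMonoid N] [Module R N] [Fintype ι] (f : MultilinearMap R (fun _ : ι => M) N)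
    (S : ι → Set M) (hf : ∀ x, (∀ i, x i ∈ S i) → f x = 0) (x : ι → M)
    (hx : ∀ i, x i ∈ Submodule.span R (S i)) : f x = 0 := by
  classical
  suffices H : ∀ (t : Finset ι) (x : ι → M), (∀ i, x i ∈ Submodule.span R (S i)) →
      (∀ i ∉ t, x i ∈ S i) → f x = 0 from H Finset.univ x hx (by simp)
  intro t
  induction t using Finset.induction_on with
  | empty => exact fun x _ h => hf x fun i => h i (by simp)
  | insert a t _ ih =>
    intro x hx hS
    have key : ∀ y ∈ Submodule.span R (S a), f (Function.update x a y) = 0 := by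
      intro y hy
      induction hy using Submodule.span_induction with
      | mem y hy =>
        refine ih _ (fun i => ?_) fun i hi => ?_
        · by_cases h : i = a
          · subst h; simpa using Submodule.subset_span hy
          · simpa [h] using hx i
        · by_cases h : i = a
          · subst h; simpa using hy
          · simpa [h] using hS i (by simp [h, hi])
      | zero => simp
      | add y z _ _ hy hz => simp [hy, hz]
      | smul c y _ hy => simp [hy]
    simpa using key (x a) (hx a)

namespace SphereTCFT

variable {V : Type*} [AddCommGroup V] [Module ℂ V] (C : SphereTCFT V)

/-- The homogeneous `Q`-closed fields. -/
def homogeneousClosed : Set V := {x | (∃ k, x ∈ C.gr k) ∧ C.Q x = 0}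

/-- Every closed field is a sum of homogeneous closed fields, and every exact field is a sum of
differentials of homogeneous fields. -/
lemma mem_span_homogeneous (Φ : V) :
    (C.Q Φ = 0 → Φ ∈ Submodule.span ℂ C.homogeneousClosed) ∧
    C.Q Φ ∈ Submodule.span ℂ {y | ∃ k, ∃ x ∈ C.gr k, C.Q x = y} := by
  classical
  let _ := C.gr_internal.chooseDecomposition
  -- `Q` commutes with taking homogeneous components, up to the shift of the degree
  have hcomp : ∀ (Φ : V) (j : ℤ), (DirectSum.decompose C.gr (C.Q Φ) (j + 1) : V) =
      C.Q (DirectSum.decompose C.gr Φ j) := by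
    intro Φ j
    induction Φ using DirectSum.Decomposition.inductionOn C.gr with
    | zero => simp
    | @homogeneous i m =>
      by_cases h : i = j
      · subst h
        rw [DirectSum.decompose_of_mem_same _ (C.Q_mem _ _ m.2),
          DirectSum.decompose_of_mem_same _ m.2]
      · rw [DirectSum.decompose_of_mem_ne _ (C.Q_mem _ _ m.2) (by simpa using h),
          DirectSum.decompose_of_mem_ne _ m.2 h, map_zero]
    | add m m' h h' => simp [h, h']
  have hsum := DirectSum.sum_support_decompose C.gr Φ
  constructor
  · intro h
    rw [← hsum]
    refine Submodule.sum_mem _ fun j _ => Submodule.subset_span ⟨⟨j, Subtype.prop _⟩, ?_⟩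
    rw [← hcomp, h]
    simp
  · rw [← hsum, map_sum]
    exact Submodule.sum_mem _ fun j _ => Submodule.subset_span ⟨j, _, Subtype.prop _, rfl⟩

/-- Correlators of an exact field with closed fields vanish. -/
theorem corr_exact {n : ℕ} {g : Fin (n + 1) → Frame} (hg : Separated g) (Ψ : V) {Φ : Fin n → V}
    (hΦ : ∀ i, C.Q (Φ i) = 0) : C.corr (n + 1) g (vecCons (C.Q Ψ) Φ) = 0 := by
  refine multilinear_eq_zero_of_mem_span (C.corr (n + 1) g)
    (vecCons {y | ∃ k, ∃ x ∈ C.gr k, C.Q x = y} fun _ => C.homogeneousClosed) ?_ _ ?_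
  · intro X hX
    obtain ⟨k, Ψ', hΨ', h0⟩ : ∃ k, ∃ x ∈ C.gr k, C.Q x = X 0 := by simpa using hX 0
    have hs : ∀ i : Fin n, X i.succ ∈ C.homogeneousClosed := fun i => by simpa using hX i.succ
    choose d hd using fun i => (hs i).1
    have e : X = vecCons (C.Q Ψ') fun i => X i.succ := by
      ext1 i; refine Fin.cases ?_ (fun i => ?_) i <;> simp [h0]
    -- move the exact field to infinity
    rw [e, ← C.corr_mobius (n + 1) (inversion * (g 0)⁻¹) g _ hg]
    refine C.corr_exact_at_infinity (d := vecCons k d) (hg.mul_left _) (by simp) (fun i => ?_)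
      fun i => (hs i).2
    refine Fin.cases ?_ (fun i => ?_) i
    · simpa using hΨ'
    · simpa using hd i
  · intro i
    refine Fin.cases ?_ (fun i => ?_) i
    · simpa using (C.mem_span_homogeneous Ψ).2
    · simpa using (C.mem_span_homogeneous (Φ i)).1 (hΦ i)

/-! ### Independence of positions and coordinates -/

/-- The stress-energy tensor is exact, so its correlators with closed fields vanish, and with them
those of the Virasoro descendants of closed fields. -/
lemma corr_virasoro_eq_zero {n : ℕ} {g : Fin (n + 1) → Frame} (hg : Separated g) {Φ₀ : V}
    {Φ : Fin n → V} (hΦ₀ : C.Q Φ₀ = 0) (hΦ : ∀ i, C.Q (Φ i) = 0) (k : ℤ) :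
    C.corr (n + 1) g (vecCons (C.L k Φ₀) Φ) = 0 ∧
      C.corr (n + 1) g (vecCons (C.Lbar k Φ₀) Φ) = 0 := by
  have e : g = vecCons (g 0) (fun i => g i.succ) := by
    ext1 i; refine Fin.cases ?_ (fun i => ?_) i <;> simp
  have hX : ∀ i, C.Q (vecCons Φ₀ Φ i) = 0 := by
    intro i; refine Fin.cases ?_ (fun i => ?_) i <;> simp [hΦ₀, hΦ]
  have hT : ∀ᶠ w in 𝓝[≠] (0 : ℂ),
      C.corr (n + 2) (vecCons (g 0 * shift w) g) (vecCons C.T (vecCons Φ₀ Φ)) = 0 ∧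
        C.corr (n + 2) (vecCons (g 0 * shift w) g) (vecCons C.Tbar (vecCons Φ₀ Φ)) = 0 := by
    filter_upwards [eventually_separated hg (g 0) 0] with w hw
    rw [C.T_exact, C.Tbar_exact]
    exact ⟨C.corr_exact hw _ hX, C.corr_exact hw _ hX⟩
  have h1 := C.corr_L n (g 0) (fun i => g i.succ) Φ₀ Φ k (by rwa [← e])
  have h2 := C.corr_Lbar n (g 0) (fun i => g i.succ) Φ₀ Φ k (by rwa [← e])
  simp only [← e] at h1 h2
  obtain ⟨r, h1, h2, hr, r0⟩ := (h1.and (h2.and ((eventually_circle hT).and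
    self_mem_nhdsWithin))).exists
  have r0' : (0 : ℝ) ≤ r := (Set.mem_Ioi.1 r0).le
  have hz : ∀ f : ℂ → ℂ, (∀ w, ‖w‖ = r → f w = 0) → (∮ w in C(0, r), f w) = 0 := by
    intro f hf
    rw [circleIntegral.integral_congr r0' (g := fun _ => 0) fun w hw => hf w (by simpa using hw)]
    simp [circleIntegral]
  constructor
  · rw [h1, oint, hz _ fun w hw => by rw [(hr w hw).1, mul_zero], hz _ fun w _ => by simp]
    simp
  · rw [h2, oint, hz _ fun w _ => by simp, hz _ fun w hw => by rw [(hr w hw).2]; simp]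
    simp

/-- Moving a closed field along translations in a Möbius coordinate: the possible positions form
the complement of a finite set, which is connected. -/
lemma corr_mul_shift {n : ℕ} {g : Fin n → Frame} {h : Frame} {Φ₀ : V} {Φ : Fin n → V}
    (hΦ₀ : C.Q Φ₀ = 0) (hΦ : ∀ i, C.Q (Φ i) = 0) (w : ℂ) (hs : Separated (vecCons h g))
    (hw : Separated (vecCons (h * shift w) g)) :
    C.corr (n + 1) (vecCons (h * shift w) g) (vecCons Φ₀ Φ) =
      C.corr (n + 1) (vecCons h g) (vecCons Φ₀ Φ) := by
  have hfin := finite_not_separated (separated_cons.1 hs).1 h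
  have hd : ∀ z ∈ {w : ℂ | ¬ Separated (vecCons (h * shift w) g)}ᶜ,
      HasFDerivAt (fun w => C.corr (n + 1) (vecCons (h * shift w) g) (vecCons Φ₀ Φ))
        (0 : ℂ →L[ℝ] ℂ) z := by
    intro z hz
    have hz : Separated (vecCons (h * shift z) g) := by simpa using hz
    refine (C.hasFDerivAt_corr Φ₀ Φ hz).congr_fderiv ?_
    ext1 v
    have := C.corr_virasoro_eq_zero hz hΦ₀ hΦ (-1)
    simp [this.1, this.2]
  have hconn := (hfin.countable.isPathConnected_compl_of_one_lt_rank
    (by simp [Complex.rank_real_complex])).isConnected.isPreconnected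
  have := hfin.isClosed.isOpen_compl.is_const_of_fderiv_eq_zero (𝕜 := ℝ) hconn
    (fun z hz => (hd z hz).differentiableAt.differentiableWithinAt) (fun z hz => (hd z hz).fderiv)
    (x := w) (y := 0) (by simpa using hw) (by simpa [shift_zero] using hs)
  simpa [shift_zero] using this

lemma corr_mul_special_closed {n : ℕ} {g : Fin n → Frame} {h : Frame} {Φ₀ : V} {Φ : Fin n → V}
    (hΦ₀ : C.Q Φ₀ = 0) (hΦ : ∀ i, C.Q (Φ i) = 0) (x : ℂ) (hs : Separated (vecCons h g)) :
    C.corr (n + 1) (vecCons (h * special x) g) (vecCons Φ₀ Φ) =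
      C.corr (n + 1) (vecCons h g) (vecCons Φ₀ Φ) := by
  have := C.corr_mul_special (Φ := vecCons Φ₀ Φ) (i := 0)
    (fun g hg => by simpa [update_vecCons_zero] using (C.corr_virasoro_eq_zero hg hΦ₀ hΦ 1).1)
    (fun g hg => by simpa [update_vecCons_zero] using (C.corr_virasoro_eq_zero hg hΦ₀ hΦ 1).2) hs x
  simpa only [update_vecCons_zero, cons_val_zero] using this

lemma corr_mul_dil_closed {n : ℕ} {g : Fin n → Frame} {h : Frame} {Φ₀ : V} {Φ : Fin n → V}
    (hΦ₀ : C.Q Φ₀ = 0) (hΦ : ∀ i, C.Q (Φ i) = 0) (s : ℂ) (hs : Separated (vecCons h g)) :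
    C.corr (n + 1) (vecCons (h * dil s) g) (vecCons Φ₀ Φ) =
      C.corr (n + 1) (vecCons h g) (vecCons Φ₀ Φ) := by
  have := C.corr_mul_dil (Φ := vecCons Φ₀ Φ) (i := 0) (k := 0) (kb := 0)
    (fun g hg => by simpa [update_vecCons_zero] using (C.corr_virasoro_eq_zero hg hΦ₀ hΦ 0).1)
    (fun g hg => by simpa [update_vecCons_zero] using (C.corr_virasoro_eq_zero hg hΦ₀ hΦ 0).2) hs s
  simpa [update_vecCons_zero] using this

/-- A correlator of closed fields does not depend on where its first field is. -/
lemma corr_move_first {n : ℕ} {g : Fin n → Frame} {h h' : Frame} {Φ₀ : V} {Φ : Fin n → V}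
    (hΦ₀ : C.Q Φ₀ = 0) (hΦ : ∀ i, C.Q (Φ i) = 0) (hs : Separated (vecCons h g))
    (hs' : Separated (vecCons h' g)) :
    C.corr (n + 1) (vecCons h' g) (vecCons Φ₀ Φ) = C.corr (n + 1) (vecCons h g) (vecCons Φ₀ Φ) := by
  have main : ∀ k : Frame, Separated (vecCons k g) → (k⁻¹ * h') 1 1 ≠ 0 →
      C.corr (n + 1) (vecCons h' g) (vecCons Φ₀ Φ) =
        C.corr (n + 1) (vecCons k g) (vecCons Φ₀ Φ) := by
    intro k hk hN
    obtain ⟨s, x, -, hx⟩ := (k⁻¹ * h').exists_eq_shift_mul hN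
    set w := (k⁻¹ * h') 0 1 / (k⁻¹ * h') 1 1
    have e : h' = k * shift w * dil s * special x := by
      rw [← mul_inv_cancel_left k h', hx]; simp only [mul_assoc]
    have h1 : Separated (vecCons (k * shift w * dil s) g) := by
      rw [separated_cons] at hs' ⊢
      simpa [e, Frame.center_mul_special] using hs'
    have h2 : Separated (vecCons (k * shift w) g) := by
      rw [separated_cons] at h1 ⊢
      simpa [Frame.center_mul_dil] using h1
    rw [e, C.corr_mul_special_closed hΦ₀ hΦ x h1, C.corr_mul_dil_closed hΦ₀ hΦ s h2,
      C.corr_mul_shift hΦ₀ hΦ w hk h2]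
  by_cases hN : (h⁻¹ * h') 1 1 = 0
  · -- `h'` is centred at the point at infinity of `h`; a special conformal change moves the latter
    have h1 : Separated (vecCons (h * special 1) g) := by
      rw [separated_cons] at hs ⊢
      simpa [Frame.center_mul_special] using hs
    rw [main _ h1 ?_, C.corr_mul_special_closed hΦ₀ hΦ 1 hs]
    have e : (h * special 1)⁻¹ * h' = special (-1) * (h⁻¹ * h') := by
      have : (special 1)⁻¹ = special (-1) := by
        rw [inv_eq_iff_mul_eq_one, ← special_add, add_neg_cancel, special_zero]
      rw [_root_.mul_inv_rev, this, mul_assoc]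
    have hdet : (h⁻¹ * h') 0 0 * (h⁻¹ * h') 1 1 - (h⁻¹ * h') 0 1 * (h⁻¹ * h') 1 0 = 1 := by
      rw [← Matrix.det_fin_two]; exact (h⁻¹ * h').2
    have e11 : (special (-1) * (h⁻¹ * h')) 1 1 = -(h⁻¹ * h') 0 1 + (h⁻¹ * h') 1 1 := by
      rw [Matrix.SpecialLinearGroup.coe_mul (special (-1)), Matrix.mul_apply, Fin.sum_univ_two,
        coe_special]
      simp
    rw [e, e11, hN, add_zero, neg_ne_zero]
    intro h0
    rw [h0, hN] at hdet
    simp at hdet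
  · exact main h hs hN

/-- A correlator of homogeneous closed fields does not depend on where its `i`-th field is. -/
lemma corr_move {n : ℕ} {Φ : Fin n → V} (hΦ : ∀ i, Φ i ∈ C.homogeneousClosed) {g : Fin n → Frame}
    {i : Fin n} {h : Frame} (hs : Separated g) (hs' : Separated (Function.update g i h)) :
    C.corr n (Function.update g i h) Φ = C.corr n g Φ := by
  cases n with
  | zero => exact i.elim0
  | succ n =>
    choose d hd using fun i => (hΦ i).1
    obtain ⟨ε, ε0, hε⟩ := C.corr_perm (Equiv.swap 0 i) d
    refine mul_left_cancel₀ ε0 ?_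
    rw [← hε _ Φ hs' hd, ← hε _ Φ hs hd]
    have hinj : Function.Injective (Equiv.swap 0 i) := (Equiv.swap 0 i).injective
    have e1 : Φ ∘ Equiv.swap 0 i = vecCons (Φ i) fun j => Φ (Equiv.swap 0 i j.succ) := by
      ext1 j; refine Fin.cases ?_ (fun j => ?_) j <;> simp
    have e2 : g ∘ Equiv.swap 0 i = vecCons (g i) fun j => g (Equiv.swap 0 i j.succ) := by
      ext1 j; refine Fin.cases ?_ (fun j => ?_) j <;> simp
    have e3 : Function.update g i h ∘ Equiv.swap 0 i =
        vecCons h fun j => g (Equiv.swap 0 i j.succ) := by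
      ext1 j
      refine Fin.cases ?_ (fun j => ?_) j
      · simp
      · have : Equiv.swap 0 i j.succ ≠ i := fun hj =>
          Fin.succ_ne_zero j (hinj (hj.trans (Equiv.swap_apply_left 0 i).symm))
        simp [this]
    have s2 := hs.comp_injective hinj
    have s3 := hs'.comp_injective hinj
    rw [e2] at s2
    rw [e3] at s3
    rw [e1, e2, e3]
    exact C.corr_move_first (hΦ i).2 (fun j => (hΦ _).2) s2 s3

/-- Correlators of closed fields are constant. Two configurations are compared through a third one
that is disjoint from both, to which the points are moved one at a time. -/
theorem corr_eq_of_closed {n : ℕ} {Φ : Fin n → V} (hΦ : ∀ i, C.Q (Φ i) = 0) {g g' : Fin n → Frame}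
    (hg : Separated g) (hg' : Separated g') : C.corr n g Φ = C.corr n g' Φ := by
  have hfin := (finite_not_separated hg 1).union (finite_not_separated hg' 1)
  let z : Fin n → ℂ := fun i => hfin.infinite_compl.natEmbedding _ i
  have hz : Separated fun i => shift (z i) := by
    intro i j hij
    have h1 : z i = z j := by simpa [center_shift] using hij
    exact Fin.ext ((hfin.infinite_compl.natEmbedding _).injective (Subtype.ext h1))
  have hzm : ∀ i, Separated (vecCons (shift (z i)) g) ∧ Separated (vecCons (shift (z i)) g') := by
    intro i
    have := (hfin.infinite_compl.natEmbedding _ i).2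
    simpa using this
  have key : ∀ k : Fin n → Frame, Separated k → (∀ i, Separated (vecCons (shift (z i)) k)) →
      ∀ X : Fin n → V, (∀ i, X i ∈ C.homogeneousClosed) →
        C.corr n (fun i => shift (z i)) X = C.corr n k X := by
    intro k hk hzk X hX
    have hsep : ∀ t : Finset (Fin n), Separated (t.piecewise (fun i => shift (z i)) k) := by
      intro t i j hij
      have hne : ∀ i j, (shift (z i)).center ≠ (k j).center := fun i j =>
        (separated_cons.1 (hzk i)).2 j
      by_cases hi : i ∈ t <;> by_cases hj : j ∈ t <;> simp [hi, hj] at hij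
      · exact hz hij
      · exact absurd hij (hne i j)
      · exact absurd hij.symm (hne j i)
      · exact hk hij
    have hind : ∀ t : Finset (Fin n),
        C.corr n (t.piecewise (fun i => shift (z i)) k) X = C.corr n k X := by
      intro t
      induction t using Finset.induction_on with
      | empty => simp
      | insert a t _ ih =>
        have hs := hsep (insert a t)
        rw [Finset.piecewise_insert] at hs ⊢
        rw [C.corr_move hX (hsep t) hs, ih]
    simpa using hind Finset.univ
  have h0 : (C.corr n g - C.corr n g') Φ = 0 := by
    refine multilinear_eq_zero_of_mem_span _ (fun _ => C.homogeneousClosed) ?_ Φ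
      fun i => (C.mem_span_homogeneous (Φ i)).1 (hΦ i)
    intro X hX
    rw [_root_.sub_apply, ← key g hg (fun i => (hzm i).1) X hX,
      ← key g' hg' (fun i => (hzm i).2) X hX, sub_self]
  exact sub_eq_zero.1 h0

end SphereTCFT

end TopCFT

theorem lemmal33 {V : Type*} [AddCommGroup V] [Module ℂ V] (C : TopCFT.SphereTCFT V)
    (n : ℕ) (Φ : Fin n → V) (hΦ : ∀ i, C.Q (Φ i) = 0) :
    -- (i) the correlator of the `Φ i` at distinct points `z i` of the Riemann sphere, in whatever
    -- Möbius coordinates centred there, is a constant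
    (∃ k : ℂ, ∀ z : Fin n → OnePoint ℂ, Function.Injective z →
      ∀ g : Fin n → TopCFT.Frame, (∀ i, (g i).center = z i) → C.corr n g Φ = k) ∧
    -- (ii) a correlator of an exact field `Q Ψ` with the `Φ i` vanishes
    (∀ (Ψ : V) (z₀ : OnePoint ℂ) (z : Fin n → OnePoint ℂ),
      Function.Injective (Matrix.vecCons z₀ z) →
      ∀ (g₀ : TopCFT.Frame) (g : Fin n → TopCFT.Frame), g₀.center = z₀ →
        (∀ i, (g i).center = z i) →
        C.corr (n + 1) (Matrix.vecCons g₀ g) (Matrix.vecCons (C.Q Ψ) Φ) = 0) := by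
  constructor
  · refine ⟨C.corr n (fun i => TopCFT.shift (i : ℕ)) Φ, fun z hz g hg => ?_⟩
    refine C.corr_eq_of_closed hΦ ?_ ?_
    · rw [TopCFT.Separated, funext hg]
      exact hz
    · intro i j hij
      simpa [TopCFT.center_shift, Fin.ext_iff] using hij
  · intro Ψ z₀ z hz g₀ g h₀ hg
    refine C.corr_exact ?_ Ψ hΦ
    have e : (fun i => (Matrix.vecCons g₀ g i).center) = Matrix.vecCons z₀ z := by
      ext1 i; refine Fin.cases ?_ (fun i => ?_) i <;> simp [h₀, hg]
    rw [TopCFT.Separated, e]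
    exact hz
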